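/- Let $A,B,C$ be real numbers with $A\ge 1$, $B,C\ge 0$. A map $f\colon X\to Y$ of metric spaces is an $(A,B)$-quasi-isometric embedding if $\frac1A d_X(x_1,x_2)-B\le d_Y(f(x_1),f(x_2))\le A\,d_X(x_1,x_2)+B$ for all $x_1,x_2\in X$. The spaces $X,Y$ are $(A,B,C)$-quasi-isometric if there are $(A,B)$-quasi-isometric embeddings $f\colon X\to Y$ and $g\colon Y\to X$ with $\sup_{x\in X} d_X(g(f(x)),x)<C$ and $\sup_{y\in Y} d_Y(f(g(y)),y)<C$. The quasi-isometric distance is $$\hat d(X,Y)=\inf\{r>0 \mid X \text{ and } Y \text{ are } (1+r,r,r)\text{-quasi-isometric}\}\in[0,\infty].$$ Let $(X_k)_{k\in\mathbb N}$ be a sequence of metric spaces and $Y$ a metric space such that $X_k$ converges quasi-isometrically to $Y$, that is, $\hat d(X_k,Y)\to 0$. Then: 1. If every $X_k$ is totally bounded, then $Y$ is totally bounded. 2. If every $X_k$ is bounded, then $Y$ is bounded. Moreover, $\operatorname{diam} X_k\to\operatorname{diam} Y$ in $[0,\infty]$ (whether or not the spaces are bounded). 3. If every $X_k$ is separable, then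 $Y$ is separable. 4. If every $X_k$ is proper (closed balls are compact) and $Y$ is complete, then $Y$ is proper. 5. If every $X_k$ is a length space (the distance of any two points is the infimum of the lengths of the continuous curves joining them) and $Y$ is complete, then $Y$ is a length space. 6. If every $X_k$ is proper and geodesic (any two points are joined by an isometrically embedded interval) and $Y$ is complete, then $Y$ is proper and geodesic. 7. Let $\delta\in\mathbb R$. If every $X_k$ is $\delta$-hyperbolic, then $Y$ is $\delta$-hyperbolic; here $X$ is $\delta$-hyperbolic if $(x\cdot y)_w\ge\min\{(x\cdot z)_w,(z\cdot y)_w\}-\delta$ for all $w,x,y,z\in X$, where $(x\cdot y)_w=\frac12\big(d(x,w)+d(y,w)-d(x,y)\big)$. 8. Let $\kappa\in\mathbb R$, and let $D_\kappa=\pi/\sqrt\kappa$ if $\kappa>0$ and $D_\kappa=\infty$ otherwise. If every $X_k$ is a $\mathrm{CAT}^\kappa$ space, then every geodesic triangle in $Y$ of perimeter less than $2D_\kappa$ satisfies the $\mathrm{CAT}^\kappa$ inequality; if in addition $Y$ is complete, then $Y$ is a $\mathrm{CAT}^\kappa$ space. Here a geodesic triangle satisfies the $\mathrm{CAT}^\kappa$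 inequality if the distance of any two of its points is at most the distance of the corresponding points of a comparison triangle (one with the same side lengths) in the simply connected surface of constant curvature $\kappa$, and a metric space is a $\mathrm{CAT}^\kappa$ space if any two of its points at distance less than $D_\kappa$ are joined by a geodesic and all its geodesic triangles of perimeter less than $2D_\kappa$ satisfy the $\mathrm{CAT}^\kappa$ inequality. -/

import Mathlib

open Filter Topology
open scoped ENNReal

noncomputable section

namespace QIConv

/-! ### Quasi-isometric distance -/

section QI

variable {X : Type*} {Y : Type*} [MetricSpace X] [MetricSpace Y]

/-- `f` is an `(A, B)`-quasi-isometric embedding. -/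
def IsQIEmbedding (A B : ℝ) (f : X → Y) : Prop :=
  ∀ x₁ x₂ : X, 1 / A * dist x₁ x₂ - B ≤ dist (f x₁) (f x₂) ∧
    dist (f x₁) (f x₂) ≤ A * dist x₁ x₂ + B

/-- `f` and `g` are `C`-close: `sup_x d (f x, g x) < C`, the supremum being taken in `[0, ∞]`. -/
def IsClose (C : ℝ) (f g : X → Y) : Prop :=
  (⨆ x : X, edist (f x) (g x)) < ENNReal.ofReal C

variable (X Y)

/-- `X` and `Y` are `(A, B, C)`-quasi-isometric (used for `A ≥ 1`, `B ≥ 0`, `C ≥ 0`). -/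
def AreQuasiIsometric (A B C : ℝ) : Prop :=
  ∃ (f : X → Y) (g : Y → X), IsQIEmbedding A B f ∧ IsQIEmbedding A B g ∧
    IsClose C (g ∘ f) id ∧ IsClose C (f ∘ g) id

/-- The quasi-isometric distance, with values in `[0, ∞]`
(it is `∞` when there is no admissible `r`). -/
def qiDist : ℝ≥0∞ :=
  sInf {d : ℝ≥0∞ | ∃ r : ℝ, 0 < r ∧ AreQuasiIsometric X Y (1 + r) r r ∧ d = ENNReal.ofReal r}

end QI

/-! ### Length spaces, geodesics, hyperbolicity -/

section Spaces

variable {X : Type*} [MetricSpace X]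

/-- `c`, restricted to `[0, dist x y]`, is a geodesic from `x` to `y`. -/
def IsGeodesicPath (c : ℝ → X) (x y : X) : Prop :=
  c 0 = x ∧ c (dist x y) = y ∧
    ∀ s ∈ Set.Icc 0 (dist x y), ∀ t ∈ Set.Icc 0 (dist x y), dist (c s) (c t) = |s - t|

/-- The Gromov product of `x` and `y` with respect to `w`. -/
def gromovProduct (w x y : X) : ℝ := (dist x w + dist y w - dist x y) / 2

variable (X)

/-- The distance of any two points is the infimum of the lengths of the paths joining them. -/
def IsLengthSpace : Prop :=
  ∀ x y : X, edist x y = ⨅ γ : Path x y, eVariationOn γ Set.univ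

/-- Any two points are joined by a geodesic. -/
def IsGeodesicSpace : Prop := ∀ x y : X, ∃ c : ℝ → X, IsGeodesicPath c x y

/-- Gromov's four-point definition of `δ`-hyperbolicity. -/
def IsHyperbolic (δ : ℝ) : Prop :=
  ∀ w x y z : X,
    min (gromovProduct w x z) (gromovProduct w z y) - δ ≤ gromovProduct w x y

end Spaces

/-! ### The CAT(κ) condition -/

/-- `t < D_κ`, where `D_κ = π / √κ` for `κ > 0` and `D_κ = ∞` for `κ ≤ 0`. -/
def BelowModelDiam (κ t : ℝ) : Prop := 0 < κ → t < Real.pi / √κ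

/-- The distance of the sphere of curvature `κ > 0`: the angular distance of the unit sphere,
divided by `√κ`. -/
def sphereDist (κ : ℝ) (a b : Metric.sphere (0 : EuclideanSpace ℝ (Fin 3)) 1) : ℝ :=
  InnerProductGeometry.angle (a : EuclideanSpace ℝ (Fin 3)) (b : EuclideanSpace ℝ (Fin 3)) / √κ

/-- The distance of the hyperbolic plane of curvature `κ < 0`: the distance of the upper half
plane of curvature `-1`, divided by `√(-κ)`. -/
def hyperbolicDist (κ : ℝ) (a b : UpperHalfPlane) : ℝ := dist a b / √(-κ)

/-- Every geodesic triangle of `X` with perimeter `< 2 D_κ` is at least as thin as its comparison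
triangle in `(M, ρ)`. The triangle has the vertices `v 0, v 1, v 2` and the side `c i` from `v i`
to `v (i + 1)` (indices modulo 3); `v'` is a comparison triangle, `x', y'` are the comparison
points of the points `x, y` of the triangle. -/
def TriangleComparison (X : Type*) [MetricSpace X] (κ : ℝ) (M : Type) (ρ : M → M → ℝ) : Prop :=
  ∀ (v : Fin 3 → X) (c : Fin 3 → ℝ → X),
    (∀ i, IsGeodesicPath (c i) (v i) (v (i + 1))) →
    BelowModelDiam κ ((∑ i, dist (v i) (v (i + 1))) / 2) →
    ∀ v' : Fin 3 → M, (∀ i, ρ (v' i) (v' (i + 1)) = dist (v i) (v (i + 1))) →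
    ∀ i j : Fin 3,
    ∀ x ∈ c i '' Set.Icc 0 (dist (v i) (v (i + 1))),
    ∀ y ∈ c j '' Set.Icc 0 (dist (v j) (v (j + 1))),
    ∀ x' y' : M,
      ρ (v' i) x' = dist (v i) x → ρ x' (v' (i + 1)) = dist x (v (i + 1)) →
      ρ (v' j) y' = dist (v j) y → ρ y' (v' (j + 1)) = dist y (v (j + 1)) →
      dist x y ≤ ρ x' y'

/-- All geodesic triangles of `X` of perimeter `< 2 D_κ` satisfy the `CAT(κ)` inequality, that is,
the comparison with the model plane of constant curvature `κ`. -/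
def CATInequality (X : Type*) [MetricSpace X] (κ : ℝ) : Prop :=
  (κ = 0 → TriangleComparison X κ (EuclideanSpace ℝ (Fin 2)) dist) ∧
  (0 < κ → TriangleComparison X κ (Metric.sphere (0 : EuclideanSpace ℝ (Fin 3)) 1)
    (sphereDist κ)) ∧
  (κ < 0 → TriangleComparison X κ UpperHalfPlane (hyperbolicDist κ))

/-- `X` is a `CAT(κ)` space: any two points at distance `< D_κ` are joined by a geodesic, and the
`CAT(κ)` inequality holds. -/
def IsCAT (X : Type*) [MetricSpace X] (κ : ℝ) : Prop :=
  (∀ x y : X, BelowModelDiam κ (dist x y) → ∃ c : ℝ → X, IsGeodesicPath c x y) ∧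
  CATInequality X κ

end QIConv

end

noncomputable section

namespace QIConv

/-! ### Sequences of quasi-isometries with constants tending to the trivial ones -/

section Basic

variable {X Y : Type*} [MetricSpace X] [MetricSpace Y]

/-! Convergence yields, for suitably chosen members of the sequence, maps `f n` to `Y` and `g n`
from `Y` whose constants tend to the trivial ones. Then the distance of `g n y` and `g n z` tends to
that of `y` and `z`, the maps `f n` preserve limits of distances, and `f n (g n y)` tends to `y`.
Closed conditions on the distances of finitely many points, such as hyperbolicity, therefore pass to
`Y` at once; finite nets, dense sets and approximate midpoints are transported by `f n`. A complete
space with approximate midpoints is a length space by dyadic subdivision. In a proper limit,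
geodesics arise from compactness.

For `CAT(κ)` the obstacle is that geodesics of `Y` are not given as limits of geodesics, so triangle
comparison is not visibly a closed condition. It is replaced by an inequality of Stewart type: if
`z` lies on a geodesic from `u` to `w` of length `l`, at distance `s` from `u`, then `S l * C (d(p,
z)) ≤ S (l - s) * C (d(p, u)) + S s * C (d(p, w)) - K l s`, with `C` increasing and equality in the
model plane. When geodesics exist this follows from triangle comparison
(`ModelPlane.stewartInequality`), and it always implies it (`ModelPlane.triangleComparison`).

The inequality is continuous in the distances, and it is rigid: if the distances of `p` to `u` and
`w` are nearly `s` and `l - s`, it forces `p` to be near `z` (`eventually_dist_geodesic_lt`).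
Rigidity is used twice. It shows that `g n` carries a geodesic of `Y` close to geodesics of `X n`,
so that the inequality passes to `Y`; and it shows that the images under `f n` of geodesic points
form Cauchy sequences, which gives geodesics in a complete `Y` without compactness. -/

lemma IsQIEmbedding.dist_le {r : ℝ} (hr : 0 < r) {f : X → Y} (hf : IsQIEmbedding (1 + r) r f)
    (x₁ x₂ : X) : dist x₁ x₂ ≤ (1 + r) * (dist (f x₁) (f x₂) + r) := by
  have h := (hf x₁ x₂).1
  have h1 : 1 / (1 + r) * dist x₁ x₂ ≤ dist (f x₁) (f x₂) + r := by linarith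
  rwa [one_div, inv_mul_le_iff₀ (by positivity)] at h1

omit [MetricSpace X] in
lemma IsClose.dist_lt {C : ℝ} {f g : X → Y} (h : IsClose C f g) (x : X) :
    dist (f x) (g x) < C := by
  have h1 : edist (f x) (g x) < ENNReal.ofReal C :=
    lt_of_le_of_lt (le_iSup (fun x => edist (f x) (g x)) x) h
  rw [edist_dist] at h1
  exact (ENNReal.ofReal_lt_ofReal_iff_of_nonneg dist_nonneg).1 h1

/-- Working in `[0, ∞]` treats bounded and unbounded spaces together. Applied to both `f` and `g`,
this bounds each of the two diameters by the other. -/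
lemma ediam_univ_le_of_dist_le {r : ℝ} (hr : 0 < r) {f : X → Y}
    (hf : ∀ x₁ x₂, dist x₁ x₂ ≤ (1 + r) * (dist (f x₁) (f x₂) + r)) :
    Metric.ediam (Set.univ : Set X) ≤
      ENNReal.ofReal (1 + r) * (Metric.ediam (Set.univ : Set Y) + ENNReal.ofReal r) := by
  refine Metric.ediam_le fun x _ y _ => ?_
  calc edist x y = ENNReal.ofReal (dist x y) := edist_dist _ _
    _ ≤ ENNReal.ofReal ((1 + r) * (dist (f x) (f y) + r)) := ENNReal.ofReal_le_ofReal (hf x y)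
    _ = ENNReal.ofReal (1 + r) * (edist (f x) (f y) + ENNReal.ofReal r) := by
        rw [ENNReal.ofReal_mul (by positivity), ENNReal.ofReal_add dist_nonneg hr.le, edist_dist]
    _ ≤ _ := by
        gcongr
        exact Metric.edist_le_ediam_of_mem (Set.mem_univ _) (Set.mem_univ _)

variable (X Y) in
lemma exists_areQuasiIsometric_of_qiDist_lt {ε : ℝ} (h : qiDist X Y < ENNReal.ofReal ε) :
    ∃ r, 0 < r ∧ r < ε ∧ AreQuasiIsometric X Y (1 + r) r r := by
  obtain ⟨d, ⟨r, hr, hq, rfl⟩, hd⟩ := sInf_lt_iff.1 h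
  exact ⟨r, hr, (ENNReal.ofReal_lt_ofReal_iff_of_nonneg hr.le).1 hd, hq⟩

end Basic

/-- Maps between the members of a sequence of spaces and `Y` that exhibit the convergence of the
sequence to `Y`. -/
structure QIApproximation (X : ℕ → Type*) [∀ n, MetricSpace (X n)] (Y : Type*)
    [MetricSpace Y] where
  /-- the constants of the quasi-isometries -/
  r : ℕ → ℝ
  /-- the maps to the limit -/
  f : ∀ n, X n → Y
  /-- the maps from the limit -/
  g : ∀ n, Y → X n
  r_pos : ∀ n, 0 < r n
  tendsto_r : Tendsto r atTop (𝓝 0)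
  qi_f : ∀ n, IsQIEmbedding (1 + r n) (r n) (f n)
  qi_g : ∀ n, IsQIEmbedding (1 + r n) (r n) (g n)
  dist_gf : ∀ n x, dist (g n (f n x)) x < r n
  dist_fg : ∀ n y, dist (f n (g n y)) y < r n

/-! ### Choice of quasi-isometries and convergence of the diameters -/

section Convergence

variable {X : ℕ → Type*} [∀ k, MetricSpace (X k)] {Y : Type*} [MetricSpace Y]

lemma eventually_areQuasiIsometric (hXY : Tendsto (fun k => qiDist (X k) Y) atTop (𝓝 0))
    {ε : ℝ} (hε : 0 < ε) :
    ∀ᶠ k in atTop, ∃ r, 0 < r ∧ r < ε ∧ AreQuasiIsometric (X k) Y (1 + r) r r := by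
  filter_upwards [hXY.eventually_lt_const (ENNReal.ofReal_pos.2 hε)] with k hk
  exact exists_areQuasiIsometric_of_qiDist_lt _ _ hk

/-- The indices `φ n` need not increase: every inherited property is assumed for all members of the
sequence, so only the decay of the constants matters. -/
lemma exists_qiApproximation (hXY : Tendsto (fun k => qiDist (X k) Y) atTop (𝓝 0)) :
    ∃ φ : ℕ → ℕ, Nonempty (QIApproximation (fun n => X (φ n)) Y) := by
  have h (n : ℕ) : ∃ k r, 0 < r ∧ r < 1 / ((n : ℝ) + 1) ∧
      AreQuasiIsometric (X k) Y (1 + r) r r :=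
    (eventually_areQuasiIsometric hXY (by positivity)).exists
  choose φ r hr hrn f g hf hg hgf hfg using h
  refine ⟨φ, ⟨⟨r, f, g, hr, ?_, hf, hg, fun n => (hgf n).dist_lt, fun n => (hfg n).dist_lt⟩⟩⟩
  exact squeeze_zero (fun n => (hr n).le) (fun n => (hrn n).le)
    tendsto_one_div_add_atTop_nhds_zero_nat

lemma tendsto_ediam (hXY : Tendsto (fun k => qiDist (X k) Y) atTop (𝓝 0)) :
    Tendsto (fun k => Metric.ediam (Set.univ : Set (X k))) atTop
      (𝓝 (Metric.ediam (Set.univ : Set Y))) := by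
  set D := Metric.ediam (Set.univ : Set Y)
  have hupper (ε : ℝ) (hε : 0 < ε) : ∀ᶠ k in atTop,
      Metric.ediam (Set.univ : Set (X k)) ≤ ENNReal.ofReal (1 + ε) * (D + ENNReal.ofReal ε) ∧
      D ≤ ENNReal.ofReal (1 + ε) *
        (Metric.ediam (Set.univ : Set (X k)) + ENNReal.ofReal ε) := by
    filter_upwards [eventually_areQuasiIsometric hXY hε] with k ⟨r, hr, hrε, f, g, hf, hg, _⟩
    constructor
    · refine (ediam_univ_le_of_dist_le hr (hf.dist_le hr)).trans ?_
      gcongr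
    · refine (ediam_univ_le_of_dist_le hr (hg.dist_le hr)).trans ?_
      gcongr
  have hlim : Tendsto (fun ε : ℝ => ENNReal.ofReal ε) (𝓝[>] 0) (𝓝 0) := by
    have := (ENNReal.continuous_ofReal.tendsto 0).mono_left
      (nhdsWithin_le_nhds (s := Set.Ioi (0 : ℝ)))
    simpa using this
  have hlim1 : Tendsto (fun ε : ℝ => ENNReal.ofReal (1 + ε)) (𝓝[>] 0) (𝓝 1) := by
    have := ((ENNReal.continuous_ofReal.comp (continuous_const.add continuous_id)).tendsto
      (0 : ℝ)).mono_left (nhdsWithin_le_nhds (s := Set.Ioi (0 : ℝ))) (f := fun ε : ℝ =>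
        ENNReal.ofReal (1 + ε))
    simpa using this
  have hpos : ∀ᶠ ε : ℝ in 𝓝[>] 0, 0 < ε := eventually_mem_nhdsWithin
  refine tendsto_order.2 ⟨fun a ha => ?_, fun b hb => ?_⟩
  -- A diameter of `X k` at most `a` would give `D ≤ (1 + ε) * (a + ε)`, which fails for small `ε`
  -- because `a < D`.
  · have h1 : Tendsto (fun ε : ℝ => ENNReal.ofReal (1 + ε) * (a + ENNReal.ofReal ε)) (𝓝[>] 0)
        (𝓝 (1 * (a + 0))) :=
      ENNReal.Tendsto.mul hlim1 (Or.inl one_ne_zero) (tendsto_const_nhds.add hlim)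
        (Or.inr ENNReal.one_ne_top)
    rw [one_mul, add_zero] at h1
    obtain ⟨ε, hεD, hε⟩ := ((h1.eventually_lt_const ha).and hpos).exists
    filter_upwards [hupper ε hε] with k hk
    by_contra hcon
    refine hεD.not_ge (hk.2.trans ?_)
    gcongr
    exact not_lt.1 hcon
  · have h1 : Tendsto (fun ε : ℝ => ENNReal.ofReal (1 + ε) * (D + ENNReal.ofReal ε)) (𝓝[>] 0)
        (𝓝 (1 * (D + 0))) :=
      ENNReal.Tendsto.mul hlim1 (Or.inl one_ne_zero) (tendsto_const_nhds.add hlim)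
        (Or.inr ENNReal.one_ne_top)
    rw [one_mul, add_zero] at h1
    obtain ⟨ε, hεD, hε⟩ := ((h1.eventually_lt_const hb).and hpos).exists
    filter_upwards [hupper ε hε] with k hk
    exact hk.1.trans_lt hεD

end Convergence

/-! ### Properties inherited through nets, dense sets and limits of distances -/

namespace QIApproximation

variable {X : ℕ → Type*} [∀ n, MetricSpace (X n)] {Y : Type*} [MetricSpace Y]
  (A : QIApproximation X Y)

lemma eventually_r_lt {ε : ℝ} (hε : 0 < ε) : ∀ᶠ n in atTop, A.r n < ε :=
  A.tendsto_r.eventually_lt_const hε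

include A in
lemma isBounded_univ (hX : ∀ n, Bornology.IsBounded (Set.univ : Set (X n))) :
    Bornology.IsBounded (Set.univ : Set Y) := by
  have h := ediam_univ_le_of_dist_le (A.r_pos 0) ((A.qi_g 0).dist_le (A.r_pos 0))
  refine Metric.isBounded_iff_ediam_ne_top.2 (ne_top_of_le_ne_top ?_ h)
  exact ENNReal.mul_ne_top ENNReal.ofReal_ne_top
    (ENNReal.add_ne_top.2 ⟨Metric.isBounded_iff_ediam_ne_top.1 (hX 0), ENNReal.ofReal_ne_top⟩)

/-- The image under `f n` of a fine finite net of `g n '' S` is a net of `S`. Allowing a subset `S`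
makes the argument applicable to closed balls, hence to properness. -/
lemma totallyBounded {S : Set Y} (hS : ∀ n, TotallyBounded (A.g n '' S)) :
    TotallyBounded S := by
  refine Metric.totallyBounded_iff.2 fun ε hε => ?_
  obtain ⟨n, hn1, hn2⟩ :=
    ((A.eventually_r_lt one_pos).and (A.eventually_r_lt (show 0 < ε / 4 by positivity))).exists
  -- As `r n < 1`, the map `f n` at most doubles `ε / 8` up to the additive `r n`; with the error of
  -- `f n ∘ g n` the total stays below `3 * ε / 4`.
  obtain ⟨t, ht, htS⟩ := Metric.totallyBounded_iff.1 (hS n) (ε / 8) (by positivity)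
  refine ⟨A.f n '' t, ht.image _, fun y hy => ?_⟩
  obtain ⟨p, hp, hyp⟩ := Set.mem_iUnion₂.1 (htS (Set.mem_image_of_mem _ hy))
  refine Set.mem_iUnion₂.2 ⟨A.f n p, Set.mem_image_of_mem _ hp, ?_⟩
  rw [Metric.mem_ball] at hyp ⊢
  have h1 := A.dist_fg n y
  have h2 := (A.qi_f n (A.g n y) p).2
  have h3 := dist_triangle_left y (A.f n p) (A.f n (A.g n y))
  have h4 : (1 + A.r n) * dist (A.g n y) p ≤ 2 * (ε / 8) :=
    mul_le_mul (by linarith) hyp.le dist_nonneg (by norm_num)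
  linarith

include A in
lemma separableSpace (hX : ∀ n, TopologicalSpace.SeparableSpace (X n)) :
    TopologicalSpace.SeparableSpace Y := by
  choose t htc htd using fun n => TopologicalSpace.exists_countable_dense (X n)
  refine ⟨⋃ n, A.f n '' t n, Set.countable_iUnion fun n => (htc n).image _, fun y => ?_⟩
  refine Metric.mem_closure_iff.2 fun ε hε => ?_
  obtain ⟨n, hn1, hn2⟩ :=
    ((A.eventually_r_lt one_pos).and (A.eventually_r_lt (show 0 < ε / 4 by positivity))).exists
  obtain ⟨p, hp, hyp⟩ := Metric.mem_closure_iff.1 (htd n (A.g n y)) (ε / 8) (by positivity)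
  refine ⟨A.f n p, Set.mem_iUnion.2 ⟨n, Set.mem_image_of_mem _ hp⟩, ?_⟩
  have h1 := A.dist_fg n y
  have h2 := (A.qi_f n (A.g n y) p).2
  have h3 := dist_triangle_left y (A.f n p) (A.f n (A.g n y))
  have h4 : (1 + A.r n) * dist (A.g n y) p ≤ 2 * (ε / 8) :=
    mul_le_mul (by linarith) hyp.le dist_nonneg (by norm_num)
  linarith

-- Closed balls of `Y` are complete, and `g n` maps them into closed balls of `X n`, which are
-- compact.
include A in
lemma properSpace [CompleteSpace Y] (hX : ∀ n, ProperSpace (X n)) : ProperSpace Y := by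
  refine ⟨fun y R => isCompact_iff_totallyBounded_isComplete.2
    ⟨A.totallyBounded fun n => ?_, Metric.isClosed_closedBall.isComplete⟩⟩
  refine TotallyBounded.subset ?_ (isCompact_closedBall (A.g n y)
    ((1 + A.r n) * R + A.r n)).totallyBounded
  rintro _ ⟨z, hz, rfl⟩
  have h1 := (A.qi_g n z y).2
  have h2 : (1 + A.r n) * dist z y ≤ (1 + A.r n) * R :=
    mul_le_mul_of_nonneg_left hz (by linarith [A.r_pos n])
  exact Metric.mem_closedBall.2 (by linarith)

/-- `(1 + r n, r n)`-quasi-isometric embeddings preserve limits of distances. -/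
lemma tendsto_dist_of_isQIEmbedding {P Q : ℕ → Type*} [∀ n, MetricSpace (P n)]
    [∀ n, MetricSpace (Q n)] {r : ℕ → ℝ} (hr0 : Tendsto r atTop (𝓝 0))
    {h : ∀ n, P n → Q n} (hh : ∀ n, IsQIEmbedding (1 + r n) (r n) (h n)) {a b : ∀ n, P n}
    {l : ℝ} (hab : Tendsto (fun n => dist (a n) (b n)) atTop (𝓝 l)) :
    Tendsto (fun n => dist (h n (a n)) (h n (b n))) atTop (𝓝 l) := by
  have h1 : Tendsto (fun n => 1 + r n) atTop (𝓝 1) := by simpa using hr0.const_add 1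
  refine tendsto_of_tendsto_of_tendsto_of_le_of_le
    (g := fun n => 1 / (1 + r n) * dist (a n) (b n) - r n)
    (h := fun n => (1 + r n) * dist (a n) (b n) + r n) ?_ ?_
    (fun n => (hh n _ _).1) (fun n => (hh n _ _).2)
  · simpa using (((tendsto_const_nhds (x := (1 : ℝ))).div h1 one_ne_zero).mul hab).sub hr0
  · simpa using (h1.mul hab).add hr0

lemma tendsto_dist_g (y z : Y) :
    Tendsto (fun n => dist (A.g n y) (A.g n z)) atTop (𝓝 (dist y z)) :=
  tendsto_dist_of_isQIEmbedding (P := fun _ => Y) A.tendsto_r A.qi_g tendsto_const_nhds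

lemma tendsto_dist_f {a b : ∀ n, X n} {l : ℝ}
    (hab : Tendsto (fun n => dist (a n) (b n)) atTop (𝓝 l)) :
    Tendsto (fun n => dist (A.f n (a n)) (A.f n (b n))) atTop (𝓝 l) :=
  tendsto_dist_of_isQIEmbedding (Q := fun _ => Y) A.tendsto_r A.qi_f hab

lemma tendsto_f_g (y : Y) : Tendsto (fun n => A.f n (A.g n y)) atTop (𝓝 y) :=
  tendsto_iff_dist_tendsto_zero.2 <| squeeze_zero (fun _ => dist_nonneg)
    (fun n => (A.dist_fg n y).le) A.tendsto_r

lemma tendsto_gromovProduct_g (w x y : Y) :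
    Tendsto (fun n => gromovProduct (A.g n w) (A.g n x) (A.g n y)) atTop
      (𝓝 (gromovProduct w x y)) :=
  (((A.tendsto_dist_g x w).add (A.tendsto_dist_g y w)).sub (A.tendsto_dist_g x y)).div_const 2

include A in
lemma isHyperbolic {δ : ℝ} (hX : ∀ n, IsHyperbolic (X n) δ) : IsHyperbolic Y δ :=
  fun w x y z => le_of_tendsto_of_tendsto'
    (((A.tendsto_gromovProduct_g w x z).min (A.tendsto_gromovProduct_g w z y)).sub_const δ)
    (A.tendsto_gromovProduct_g w x y) fun n => hX n _ _ _ _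

end QIApproximation

/-! ### Length spaces -/

section Length

variable {Y : Type*} [MetricSpace Y]

/-- Any two points have midpoints up to an arbitrarily small error. -/
def HasApproxMidpoints (Y : Type*) [MetricSpace Y] : Prop :=
  ∀ (x y : Y) (ε : ℝ), 0 < ε → ∃ z, dist x z ≤ dist x y / 2 + ε ∧ dist z y ≤ dist x y / 2 + ε

/-- On a nearly shortest path, the intermediate value theorem gives a point at distance exactly
`dist x y / 2` from `x`; additivity of length bounds its distance to `y`. -/
lemma IsLengthSpace.hasApproxMidpoints (h : IsLengthSpace Y) : HasApproxMidpoints Y := by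
  intro x y ε hε
  have hlt : ⨅ γ : Path x y, eVariationOn γ Set.univ < ENNReal.ofReal (dist x y + ε) := by
    rw [← h x y, edist_dist]
    exact (ENNReal.ofReal_lt_ofReal_iff (by positivity)).2 (by linarith)
  obtain ⟨γ, hγ⟩ := iInf_lt_iff.1 hlt
  have hcont : Continuous fun t => dist x (γ t) := continuous_const.dist γ.continuous
  have hmem : dist x y / 2 ∈ Set.Icc (dist x (γ 0)) (dist x (γ 1)) := by
    have h0 := dist_nonneg (x := x) (y := y)
    rw [γ.source, γ.target, dist_self]
    constructor <;> linarith
  obtain ⟨t, ht⟩ := intermediate_value_univ 0 1 hcont hmem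
  refine ⟨γ t, by simp only at ht; linarith, ?_⟩
  have hsum : edist x (γ t) + edist (γ t) y ≤ eVariationOn γ Set.univ := by
    have hadd := eVariationOn.Icc_add_Icc γ (s := Set.univ) (a := 0) (b := t) (c := 1)
      t.2.1 t.2.2 (Set.mem_univ _)
    have h1 : edist (γ 0) (γ t) ≤ eVariationOn γ (Set.univ ∩ Set.Icc 0 t) :=
      eVariationOn.edist_le γ ⟨Set.mem_univ _, le_refl _, t.2.1⟩ ⟨Set.mem_univ _, t.2.1, le_refl _⟩
    have h2 : edist (γ t) (γ 1) ≤ eVariationOn γ (Set.univ ∩ Set.Icc t 1) :=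
      eVariationOn.edist_le γ ⟨Set.mem_univ _, le_refl _, t.2.2⟩ ⟨Set.mem_univ _, t.2.2, le_refl _⟩
    rw [γ.source] at h1
    rw [γ.target] at h2
    calc _ ≤ _ := add_le_add h1 h2
      _ = _ := hadd
      _ ≤ _ := eVariationOn.mono γ Set.inter_subset_left
  have hreal := hsum.trans_lt hγ
  rw [edist_dist, edist_dist, ← ENNReal.ofReal_add dist_nonneg dist_nonneg,
    ENNReal.ofReal_lt_ofReal_iff (by positivity)] at hreal
  simp only at ht
  linarith

/-- In a complete space, a sequence of finer and finer dyadic polygons with edges of length at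
most `L / 2 ^ n` converges to an `L`-Lipschitz curve. -/
lemma exists_curve_of_dyadic [CompleteSpace Y] {p : ℕ → ℕ → Y} {L : ℝ}
    (hp : ∀ n i, p (n + 1) (2 * i) = p n i)
    (hL : ∀ n i, dist (p n i) (p n (i + 1)) ≤ L / 2 ^ n) :
    ∃ c : ℝ → Y, c 0 = p 0 0 ∧ c 1 = p 0 1 ∧
      ∀ s t, 0 ≤ s → s ≤ t → dist (c s) (c t) ≤ L * (t - s) := by
  have hL0 : 0 ≤ L := by simpa using dist_nonneg.trans (hL 0 0)
  -- The `n`-th approximation is a step function through the vertices; continuity appears only in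
  -- the limit.
  let q : ℕ → ℝ → Y := fun n t => p n ⌊2 ^ n * t⌋₊
  have hq0 (n : ℕ) : q n 0 = p 0 0 := by
    have h : ∀ n, p n 0 = p 0 0 := fun n => by
      induction n with
      | zero => rfl
      | succ n ih => rw [← ih, ← hp n 0]
    simpa [q] using h n
  have hq1 (n : ℕ) : q n 1 = p 0 1 := by
    have h : ∀ n, p n (2 ^ n) = p 0 1 := fun n => by
      induction n with
      | zero => rfl
      | succ n ih => rw [← ih, ← hp n, pow_succ']
    have hfl : ⌊(2 : ℝ) ^ n * 1⌋₊ = 2 ^ n := by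
      rw [mul_one]
      exact_mod_cast Nat.floor_natCast (R := ℝ) (2 ^ n)
    simp only [q, hfl, h]
  have hcauchy (t : ℝ) (ht : 0 ≤ t) : CauchySeq fun n => q n t := by
    refine cauchySeq_of_le_geometric_two (C := 2 * L) fun n => ?_
    have h2 : (2 : ℝ) * L / 2 / 2 ^ n = L / 2 ^ n := by ring
    rw [h2]
    set a := ⌊2 ^ n * t⌋₊ with ha
    have hx0 : 0 ≤ 2 ^ n * t := by positivity
    have hle := Nat.floor_le hx0
    have hlt := Nat.lt_floor_add_one (2 ^ n * t)
    have hmul : (2 : ℝ) ^ (n + 1) * t = 2 * (2 ^ n * t) := by ring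
    have hb1 : 2 * a ≤ ⌊2 ^ (n + 1) * t⌋₊ := by
      refine Nat.le_floor ?_
      push_cast
      rw [hmul]
      linarith
    have hb2 : ⌊2 ^ (n + 1) * t⌋₊ < 2 * a + 2 := by
      refine (Nat.floor_lt (by positivity)).2 ?_
      push_cast
      rw [hmul]
      linarith
    -- Thus `q n t` and `q (n + 1) t` coincide or are consecutive vertices of the finer polygon.
    have hcases : ⌊2 ^ (n + 1) * t⌋₊ = 2 * a ∨ ⌊2 ^ (n + 1) * t⌋₊ = 2 * a + 1 := by omega
    change dist (p n a) (p (n + 1) ⌊2 ^ (n + 1) * t⌋₊) ≤ _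
    rcases hcases with h | h
    · rw [h, hp, dist_self]
      positivity
    · rw [h, ← hp n a]
      refine (hL (n + 1) (2 * a)).trans ?_
      gcongr
      · norm_num
      · omega
  have hlim (t : ℝ) : ∃ z, 0 ≤ t → Tendsto (fun n => q n t) atTop (𝓝 z) := by
    by_cases ht : 0 ≤ t
    · obtain ⟨z, hz⟩ := cauchySeq_tendsto_of_complete (hcauchy t ht)
      exact ⟨z, fun _ => hz⟩
    · exact ⟨p 0 0, fun h => (ht h).elim⟩
  choose c hc using hlim
  refine ⟨c, ?_, ?_, fun s t hs hst => ?_⟩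
  · refine tendsto_nhds_unique (hc 0 le_rfl) ?_
    simp only [hq0]
    exact tendsto_const_nhds
  · refine tendsto_nhds_unique (hc 1 zero_le_one) ?_
    simp only [hq1]
    exact tendsto_const_nhds
  -- At most `2 ^ n * (t - s) + 1` edges lie between the two vertices; the surplus edge disappears
  -- in the limit.
  · have hbound (n : ℕ) : dist (q n s) (q n t) ≤ L * (t - s) + L / 2 ^ n := by
      have hmono : ⌊2 ^ n * s⌋₊ ≤ ⌊2 ^ n * t⌋₊ := Nat.floor_le_floor (by gcongr)
      have h1 := dist_le_Ico_sum_of_dist_le hmono (f := p n) (d := fun _ => L / 2 ^ n)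
        fun _ _ => hL n _
      rw [Finset.sum_const, Nat.card_Ico, nsmul_eq_mul, Nat.cast_sub hmono] at h1
      have hlt := Nat.lt_floor_add_one (2 ^ n * s)
      have hle := Nat.floor_le (show 0 ≤ 2 ^ n * t by have := hs.trans hst; positivity)
      refine h1.trans ?_
      have h3 : L * (t - s) + L / 2 ^ n = (2 ^ n * t - 2 ^ n * s + 1) * (L / 2 ^ n) := by
        field_simp
      rw [h3]
      gcongr
      linarith
    have hgeom : Tendsto (fun n : ℕ => L * (t - s) + L / 2 ^ n) atTop (𝓝 (L * (t - s) + 0)) := by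
      refine tendsto_const_nhds.add ?_
      exact tendsto_const_nhds.div_atTop (tendsto_pow_atTop_atTop_of_one_lt one_lt_two)
    rw [add_zero] at hgeom
    exact le_of_tendsto_of_tendsto' ((hc s hs).dist (hc t (hs.trans hst))) hgeom hbound

/-- Iterated dyadic subdivision of the pair `x, y` by means of a family of midpoint maps. -/
def dyadicPoints (m : ℕ → Y → Y → Y) (x y : Y) : ℕ → ℕ → Y
  -- All indices from `1` on give `y`, so the edge bounds hold for every `i` and no range has to be
  -- tracked.
  | 0, i => if i = 0 then x else y
  | n + 1, i => if i % 2 = 0 then dyadicPoints m x y n (i / 2)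
      else m n (dyadicPoints m x y n (i / 2)) (dyadicPoints m x y n (i / 2 + 1))

omit [MetricSpace Y] in
lemma dyadicPoints_even (m : ℕ → Y → Y → Y) (x y : Y) (n i : ℕ) :
    dyadicPoints m x y (n + 1) (2 * i) = dyadicPoints m x y n i := by
  simp [dyadicPoints]

omit [MetricSpace Y] in
lemma dyadicPoints_odd (m : ℕ → Y → Y → Y) (x y : Y) (n i : ℕ) :
    dyadicPoints m x y (n + 1) (2 * i + 1) =
      m n (dyadicPoints m x y n i) (dyadicPoints m x y n (i + 1)) := by
  have h1 : (2 * i + 1) % 2 = 1 := by omega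
  have h2 : (2 * i + 1) / 2 = i := by omega
  simp [dyadicPoints, h1, h2]

lemma HasApproxMidpoints.exists_curve [CompleteSpace Y] (h : HasApproxMidpoints Y) (x y : Y)
    {ε : ℝ} (hε : 0 < ε) :
    ∃ c : ℝ → Y, c 0 = x ∧ c 1 = y ∧
      ∀ s t, 0 ≤ s → s ≤ t → dist (c s) (c t) ≤ (dist x y + ε) * (t - s) := by
  -- With the error `ε / 4 ^ (n + 1)`, halving the edge bound of level `n` and adding the error
  -- gives exactly the bound of level `n + 1`, and the total excess stays below `ε`.
  choose m hm1 hm2 using fun (n : ℕ) (a b : Y) => h a b (ε / 4 ^ (n + 1)) (by positivity)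
  have hd (n : ℕ) : ∀ i, dist (dyadicPoints m x y n i) (dyadicPoints m x y n (i + 1)) ≤
      (dist x y + ε * (1 - 1 / 2 ^ n)) / 2 ^ n := by
    induction n with
    | zero =>
      intro i
      rcases Nat.eq_zero_or_pos i with rfl | hi
      · simp [dyadicPoints]
      · simp [dyadicPoints, hi.ne']
    | succ n ih =>
      have key (i : ℕ) : dist (dyadicPoints m x y n i) (dyadicPoints m x y n (i + 1)) / 2 +
          ε / 4 ^ (n + 1) ≤ (dist x y + ε * (1 - 1 / 2 ^ (n + 1))) / 2 ^ (n + 1) := by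
        have h4 : (4 : ℝ) ^ (n + 1) = 4 * (2 ^ n * 2 ^ n) := by
          rw [pow_succ, ← mul_pow]; norm_num; ring
        have heq : (dist x y + ε * (1 - 1 / 2 ^ (n + 1))) / 2 ^ (n + 1) =
            (dist x y + ε * (1 - 1 / 2 ^ n)) / 2 ^ n / 2 + ε / 4 ^ (n + 1) := by
          rw [h4, pow_succ]
          field_simp
          ring
        rw [heq]
        gcongr
        exact ih i
      intro i
      obtain ⟨j, rfl | rfl⟩ := Nat.even_or_odd' i
      · rw [dyadicPoints_even, dyadicPoints_odd]
        exact (hm1 _ _ _).trans (key j)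
      · rw [dyadicPoints_odd, show 2 * j + 1 + 1 = 2 * (j + 1) by ring, dyadicPoints_even]
        exact (hm2 _ _ _).trans (key j)
  obtain ⟨c, hc0, hc1, hc⟩ := exists_curve_of_dyadic (L := dist x y + ε)
    (dyadicPoints_even m x y) fun n i => (hd n i).trans (by
      gcongr
      refine mul_le_of_le_one_right hε.le ?_
      have : (0 : ℝ) ≤ 1 / 2 ^ n := by positivity
      linarith)
  exact ⟨c, by simpa [dyadicPoints] using hc0, by simpa [dyadicPoints] using hc1, hc⟩

lemma HasApproxMidpoints.isLengthSpace [CompleteSpace Y] (h : HasApproxMidpoints Y) :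
    IsLengthSpace Y := by
  intro x y
  refine le_antisymm (le_iInf fun γ => ?_) (ENNReal.le_of_forall_pos_le_add fun ε hε _ => ?_)
  · simpa using eVariationOn.edist_le γ (Set.mem_univ 0) (Set.mem_univ 1)
  · obtain ⟨c, hc0, hc1, hc⟩ := h.exists_curve x y (ε := ε) hε
    have hlip : LipschitzOnWith (Real.toNNReal (dist x y + ε)) c (Set.Icc 0 1) := by
      refine LipschitzOnWith.of_dist_le_mul fun s hs t ht => ?_
      rw [Real.coe_toNNReal _ (by positivity)]
      rcases le_total s t with hst | hst
      · rw [Real.dist_eq, abs_sub_comm, abs_of_nonneg (sub_nonneg.2 hst)]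
        exact hc s t hs.1 hst
      · rw [Real.dist_eq, abs_of_nonneg (sub_nonneg.2 hst), dist_comm]
        exact hc t s ht.1 hst
    let γ : Path x y :=
      { toFun := fun t => c t
        continuous_toFun := hlip.continuousOn.comp_continuous continuous_subtype_val
          fun t => t.2
        source' := by simpa using hc0
        target' := by simpa using hc1 }
    have hvar : eVariationOn (Subtype.val : unitInterval → ℝ) Set.univ ≤ 1 := by
      have hm : MonotoneOn (Subtype.val : unitInterval → ℝ) Set.univ :=
        (Subtype.mono_coe _).monotoneOn _
      have h01 := hm.eVariationOn_eq (Set.mem_univ 0) (Set.mem_univ 1)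
      have huniv : (Set.univ : Set unitInterval) ∩ Set.Icc 0 1 = Set.univ :=
        Set.eq_univ_of_forall fun t => ⟨Set.mem_univ _, t.2.1, t.2.2⟩
      rw [huniv] at h01
      simpa using h01.le
    refine (iInf_le _ γ).trans ?_
    calc eVariationOn γ Set.univ
        = eVariationOn (c ∘ (Subtype.val : unitInterval → ℝ)) Set.univ := rfl
      _ ≤ (Real.toNNReal (dist x y + ε) : ℝ≥0∞) *
            eVariationOn (Subtype.val : unitInterval → ℝ) Set.univ :=
          hlip.comp_eVariationOn_le fun t _ => t.2
      _ ≤ (Real.toNNReal (dist x y + ε) : ℝ≥0∞) * 1 := by gcongr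
      _ = edist x y + ε := by
          rw [mul_one, edist_dist, ← ENNReal.ofReal, ENNReal.ofReal_add dist_nonneg ε.coe_nonneg,
            ENNReal.ofReal_coe_nnreal]

end Length

/-! ### Limits of length spaces -/

namespace QIApproximation

variable {X : ℕ → Type*} [∀ n, MetricSpace (X n)] {Y : Type*} [MetricSpace Y]
  (A : QIApproximation X Y)

include A in
lemma hasApproxMidpoints (hX : ∀ n, HasApproxMidpoints (X n)) : HasApproxMidpoints Y := by
  intro x y ε hε
  have hsmall (n : ℕ) : ∃ z : X n,
      dist (A.g n x) z ≤ dist (A.g n x) (A.g n y) / 2 + A.r n ∧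
      dist z (A.g n y) ≤ dist (A.g n x) (A.g n y) / 2 + A.r n := hX n _ _ _ (A.r_pos n)
  choose z hz1 hz2 using hsmall
  have hr1 : Tendsto (fun n => 1 + A.r n) atTop (𝓝 1) := by simpa using A.tendsto_r.const_add 1
  have hlim : Tendsto (fun n => (1 + A.r n) * (dist (A.g n x) (A.g n y) / 2 + A.r n) +
      A.r n + A.r n) atTop (𝓝 (dist x y / 2)) := by
    simpa using ((hr1.mul (((A.tendsto_dist_g x y).div_const 2).add A.tendsto_r)).add
      A.tendsto_r).add A.tendsto_r
  obtain ⟨n, hn⟩ := (hlim.eventually_lt_const (show dist x y / 2 < dist x y / 2 + ε by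
    linarith)).exists
  have hpos := A.r_pos n
  refine ⟨A.f n (z n), ?_, ?_⟩
  · have h1 := (A.qi_f n (A.g n x) (z n)).2
    have h2 := dist_triangle_left x (A.f n (z n)) (A.f n (A.g n x))
    have h3 := A.dist_fg n x
    have h4 := mul_le_mul_of_nonneg_left (hz1 n) (show 0 ≤ 1 + A.r n by linarith)
    linarith
  · have h1 := (A.qi_f n (z n) (A.g n y)).2
    have h2 := dist_triangle (A.f n (z n)) (A.f n (A.g n y)) y
    have h3 := A.dist_fg n y
    have h4 := mul_le_mul_of_nonneg_left (hz2 n) (show 0 ≤ 1 + A.r n by linarith)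
    linarith

include A in
lemma isLengthSpace [CompleteSpace Y] (hX : ∀ n, IsLengthSpace (X n)) : IsLengthSpace Y :=
  (A.hasApproxMidpoints fun n => (hX n).hasApproxMidpoints).isLengthSpace

/-! ### Limits of geodesics -/

variable {x y : Y} {c : ∀ n, ℝ → X n}

/-- Distances of points of geodesics between the approximations of `x` and `y`; the parameters are
cut off at the ends of the geodesics. -/
lemma tendsto_dist_geodesic
    (hc : ∀ᶠ n in atTop, IsGeodesicPath (c n) (A.g n x) (A.g n y)) {s t : ℝ}
    (hs : s ∈ Set.Icc 0 (dist x y)) (ht : t ∈ Set.Icc 0 (dist x y)) :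
    Tendsto (fun n => dist (c n (min s (dist (A.g n x) (A.g n y))))
      (c n (min t (dist (A.g n x) (A.g n y))))) atTop (𝓝 |s - t|) := by
  have hlim : Tendsto (fun n => |min s (dist (A.g n x) (A.g n y)) -
      min t (dist (A.g n x) (A.g n y))|) atTop (𝓝 |min s (dist x y) - min t (dist x y)|) :=
    ((tendsto_const_nhds.min (A.tendsto_dist_g x y)).sub
      (tendsto_const_nhds.min (A.tendsto_dist_g x y))).abs
  rw [min_eq_left hs.2, min_eq_left ht.2] at hlim
  refine hlim.congr' ?_
  filter_upwards [hc] with n hn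
  exact (hn.2.2 _ ⟨le_min hs.1 dist_nonneg, min_le_right _ _⟩ _
    ⟨le_min ht.1 dist_nonneg, min_le_right _ _⟩).symm

lemma tendsto_dist_geodesic_source
    (hc : ∀ᶠ n in atTop, IsGeodesicPath (c n) (A.g n x) (A.g n y)) {s : ℝ}
    (hs : s ∈ Set.Icc 0 (dist x y)) :
    Tendsto (fun n => dist (c n (min s (dist (A.g n x) (A.g n y)))) (A.g n x)) atTop (𝓝 s) := by
  have h := A.tendsto_dist_geodesic hc hs ⟨le_rfl, dist_nonneg⟩
  rw [sub_zero, abs_of_nonneg hs.1] at h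
  refine h.congr' ?_
  filter_upwards [hc] with n hn
  rw [min_eq_left (a := (0 : ℝ)) dist_nonneg, hn.1]

lemma tendsto_dist_geodesic_target
    (hc : ∀ᶠ n in atTop, IsGeodesicPath (c n) (A.g n x) (A.g n y)) {s : ℝ}
    (hs : s ∈ Set.Icc 0 (dist x y)) :
    Tendsto (fun n => dist (c n (min s (dist (A.g n x) (A.g n y)))) (A.g n y)) atTop
      (𝓝 (dist x y - s)) := by
  have hlim : Tendsto (fun n => |min s (dist (A.g n x) (A.g n y)) -
      dist (A.g n x) (A.g n y)|) atTop (𝓝 |min s (dist x y) - dist x y|) :=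
    ((tendsto_const_nhds.min (A.tendsto_dist_g x y)).sub (A.tendsto_dist_g x y)).abs
  rw [min_eq_left hs.2, abs_sub_comm, abs_of_nonneg (sub_nonneg.2 hs.2)] at hlim
  refine hlim.congr' ?_
  filter_upwards [hc] with n hn
  have hn2 := hn.2.2 (min s (dist (A.g n x) (A.g n y)))
    ⟨le_min hs.1 dist_nonneg, min_le_right _ _⟩ _ ⟨dist_nonneg, le_rfl⟩
  rw [hn.2.1] at hn2
  exact hn2.symm

lemma tendsto_dist_f_of_tendsto_dist_g {a : ∀ n, X n} {z : Y} {l : ℝ}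
    (h : Tendsto (fun n => dist (a n) (A.g n z)) atTop (𝓝 l)) :
    Tendsto (fun n => dist (A.f n (a n)) z) atTop (𝓝 l) := by
  refine tendsto_of_tendsto_of_dist (A.tendsto_dist_f h) (squeeze_zero (fun _ => dist_nonneg)
    (fun n => ?_) (tendsto_iff_dist_tendsto_zero.1 (A.tendsto_f_g z)))
  rw [Real.dist_eq]
  simpa [dist_comm] using abs_dist_sub_le (A.f n (A.g n z)) z (A.f n (a n))

/-- Approximate geodesics whose points converge along a filter have a geodesic as limit. -/
lemma exists_isGeodesicPath (hc : ∀ᶠ n in atTop, IsGeodesicPath (c n) (A.g n x) (A.g n y))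
    {F : Filter ℕ} [F.NeBot] (hF : F ≤ atTop)
    (hconv : ∀ s ∈ Set.Icc 0 (dist x y), ∃ z : Y,
      Tendsto (fun n => A.f n (c n (min s (dist (A.g n x) (A.g n y))))) F (𝓝 z)) :
    ∃ c' : ℝ → Y, IsGeodesicPath c' x y := by
  have hconv' (s : ℝ) : ∃ z : Y, s ∈ Set.Icc 0 (dist x y) →
      Tendsto (fun n => A.f n (c n (min s (dist (A.g n x) (A.g n y))))) F (𝓝 z) := by
    by_cases hs : s ∈ Set.Icc 0 (dist x y)
    · obtain ⟨z, hz⟩ := hconv s hs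
      exact ⟨z, fun _ => hz⟩
    · exact ⟨x, fun h => (hs h).elim⟩
  choose c' hc' using hconv'
  have h0 : (0 : ℝ) ∈ Set.Icc 0 (dist x y) := ⟨le_rfl, dist_nonneg⟩
  have h1 : dist x y ∈ Set.Icc 0 (dist x y) := ⟨dist_nonneg, le_rfl⟩
  refine ⟨c', ?_, ?_, fun s hs t ht => ?_⟩
  · refine tendsto_nhds_unique (hc' 0 h0) (((A.tendsto_f_g x).mono_left hF).congr' ?_)
    filter_upwards [hF hc] with n hn
    rw [min_eq_left dist_nonneg, hn.1]
  -- The cut-off parameter may fall short of the end of the `n`-th geodesic, so the end point is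
  -- reached only in the limit.
  · have hend := A.tendsto_dist_geodesic_target hc h1
    rw [sub_self] at hend
    have hlim2 := ((hc' _ h1).dist ((A.tendsto_f_g y).mono_left hF))
    exact dist_eq_zero.1 (tendsto_nhds_unique hlim2 ((A.tendsto_dist_f hend).mono_left hF))
  · exact tendsto_nhds_unique ((hc' s hs).dist (hc' t ht))
      ((A.tendsto_dist_f (A.tendsto_dist_geodesic hc hs ht)).mono_left hF)

-- A nonprincipal ultrafilter makes the approximate geodesics converge at all parameters at once,
-- each point staying in a compact ball; no diagonal sequence is needed.
include A in
lemma isGeodesicSpace [ProperSpace Y] (hX : ∀ n, IsGeodesicSpace (X n)) : IsGeodesicSpace Y := by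
  intro x y
  choose c hc using fun n => hX n (A.g n x) (A.g n y)
  refine A.exists_isGeodesicPath (c := c) (.of_forall hc) (F := hyperfilter ℕ)
    Nat.hyperfilter_le_atTop fun s hs => ?_
  have hev : ∀ᶠ n in atTop, A.f n (c n (min s (dist (A.g n x) (A.g n y)))) ∈
      Metric.closedBall x (s + 1) :=
    ((A.tendsto_dist_f_of_tendsto_dist_g
      (A.tendsto_dist_geodesic_source (.of_forall hc) hs)).eventually_lt_const (lt_add_one s)).mono
      fun n hn => hn.le
  obtain ⟨z, -, hz⟩ := (isCompact_closedBall x (s + 1)).ultrafilter_le_nhds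
    ((hyperfilter ℕ).map fun n => A.f n (c n (min s (dist (A.g n x) (A.g n y)))))
    (le_principal_iff.2 (Nat.hyperfilter_le_atTop hev))
  exact ⟨z, hz⟩

end QIApproximation

/-! ### The `CAT(κ)` condition as an inequality of Stewart type -/

section Model

lemma BelowModelDiam.mono {κ s t : ℝ} (ht : BelowModelDiam κ t) (hst : s ≤ t) :
    BelowModelDiam κ s := fun hκ => hst.trans_lt (ht hκ)

lemma BelowModelDiam.eventually {κ l : ℝ} (hl : BelowModelDiam κ l) {t : ℕ → ℝ}
    (ht : Tendsto t atTop (𝓝 l)) : ∀ᶠ n in atTop, BelowModelDiam κ (t n) := by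
  by_cases hκ : 0 < κ
  · filter_upwards [ht.eventually_lt_const (hl hκ)] with n hn _ using hn
  · exact .of_forall fun n h => (hκ h).elim

/-- The functions that enter Stewart's theorem in the plane of curvature `κ`. -/
structure ModelTrig (κ : ℝ) where
  /-- the function that is applied to the distances -/
  C : ℝ → ℝ
  /-- the function that gives the weights -/
  S : ℝ → ℝ
  /-- the correction term -/
  K : ℝ → ℝ → ℝ
  continuous_C : Continuous C
  continuous_S : Continuous S
  continuous_K : Continuous fun q : ℝ × ℝ => K q.1 q.2
  -- The end point `D_κ` is included because distances in the model sphere may attain it.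
  strictMonoOn_C : StrictMonoOn C {t | 0 ≤ t ∧ (0 < κ → t ≤ Real.pi / √κ)}
  S_zero : S 0 = 0
  S_pos : ∀ t, 0 < t → BelowModelDiam κ t → 0 < S t
  -- Stewart's identity for `p = z`, the source of rigidity.
  collinear : ∀ l s, S l * C 0 = S (l - s) * C s + S s * C (l - s) - K l s

/-- A two-dimensional model space of curvature `κ`: it satisfies Stewart's theorem and contains
all admissible comparison triangles. -/
structure ModelPlane (κ : ℝ) (M : Type) (ρ : M → M → ℝ) extends ModelTrig κ where
  rho_dist_self : ∀ x, ρ x x = 0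
  rho_dist_comm : ∀ x y, ρ x y = ρ y x
  rho_dist_triangle : ∀ x y z, ρ x z ≤ ρ x y + ρ y z
  rho_dist_nonneg : ∀ x y, 0 ≤ ρ x y
  rho_dist_le : ∀ x y, 0 < κ → ρ x y ≤ Real.pi / √κ
  stewart : ∀ p u w z, BelowModelDiam κ (ρ u w) → ρ u z + ρ z w = ρ u w →
    S (ρ u w) * C (ρ p z) = S (ρ z w) * C (ρ p u) + S (ρ u z) * C (ρ p w) - K (ρ u w) (ρ u z)
  exists_between : ∀ u w s, BelowModelDiam κ (ρ u w) → 0 ≤ s → s ≤ ρ u w →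
    ∃ z, ρ u z = s ∧ ρ z w = ρ u w - s
  exists_triangle : ∀ a b c, a ≤ b + c → b ≤ a + c → c ≤ a + b →
    BelowModelDiam κ ((a + b + c) / 2) → ∃ p u w, ρ p u = a ∧ ρ u w = b ∧ ρ w p = c

/-- Distances below the diameter of the model plane are in the domain of monotonicity. -/
lemma mem_domain {κ t : ℝ} (ht : 0 ≤ t) (h : BelowModelDiam κ t) :
    t ∈ {t | 0 ≤ t ∧ (0 < κ → t ≤ Real.pi / √κ)} := ⟨ht, fun hκ => (h hκ).le⟩

namespace ModelTrig

variable {κ : ℝ} (m : ModelTrig κ)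

lemma K_zero : m.K 0 0 = 0 := by
  have h := m.collinear 0 0
  rw [sub_zero, m.S_zero] at h
  linarith

lemma S_nonneg {t : ℝ} (ht : 0 ≤ t) (h : BelowModelDiam κ t) : 0 ≤ m.S t := by
  rcases ht.eq_or_lt with rfl | ht
  · exact m.S_zero.ge
  · exact (m.S_pos t ht h).le

/-- The right-hand side of Stewart's theorem. -/
def bound (l s a b : ℝ) : ℝ := m.S (l - s) * m.C a + m.S s * m.C b - m.K l s

lemma tendsto_bound {ι : Type*} {F : Filter ι} {l s a b : ι → ℝ} {l' s' a' b' : ℝ}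
    (hl : Tendsto l F (𝓝 l')) (hs : Tendsto s F (𝓝 s')) (ha : Tendsto a F (𝓝 a'))
    (hb : Tendsto b F (𝓝 b')) :
    Tendsto (fun n => m.bound (l n) (s n) (a n) (b n)) F (𝓝 (m.bound l' s' a' b')) :=
  ((((m.continuous_S.tendsto _).comp (hl.sub hs)).mul ((m.continuous_C.tendsto _).comp ha)).add
    (((m.continuous_S.tendsto _).comp hs).mul ((m.continuous_C.tendsto _).comp hb))).sub
    ((m.continuous_K.tendsto (l', s')).comp (hl.prodMk_nhds hs))

/-- For a point of the geodesic itself, the bound is the trivial one. -/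
lemma bound_lt {l s ε : ℝ} (hl : 0 < l) (hlκ : BelowModelDiam κ l)
    (hε : 0 < ε) (hεκ : BelowModelDiam κ ε) : m.bound l s s (l - s) < m.S l * m.C ε := by
  rw [bound, ← m.collinear]
  exact mul_lt_mul_of_pos_left (m.strictMonoOn_C
    (mem_domain le_rfl (hεκ.mono hε.le)) (mem_domain hε.le hεκ) hε) (m.S_pos l hl hlκ)

/-- The inequality of Stewart type that characterizes `CAT(κ)` spaces. -/
def StewartInequality (X : Type*) [MetricSpace X] : Prop :=
  ∀ (p u w : X) (c : ℝ → X) (s : ℝ), IsGeodesicPath c u w → s ∈ Set.Icc 0 (dist u w) →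
    BelowModelDiam κ ((dist p u + dist p w + dist u w) / 2) →
    m.S (dist u w) * m.C (dist p (c s)) ≤ m.bound (dist u w) s (dist p u) (dist p w)

end ModelTrig

/-! ### Equivalence of triangle comparison and Stewart's inequality -/

variable {X : Type*} [MetricSpace X] {κ : ℝ} {M : Type} {ρ : M → M → ℝ}

lemma IsGeodesicPath.dist_left {c : ℝ → X} {u w : X} (hc : IsGeodesicPath c u w) {s : ℝ}
    (hs : s ∈ Set.Icc 0 (dist u w)) : dist u (c s) = s := by
  have h := hc.2.2 0 ⟨le_rfl, dist_nonneg⟩ s hs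
  rwa [hc.1, zero_sub, abs_neg, abs_of_nonneg hs.1] at h

lemma IsGeodesicPath.dist_right {c : ℝ → X} {u w : X} (hc : IsGeodesicPath c u w) {s : ℝ}
    (hs : s ∈ Set.Icc 0 (dist u w)) : dist (c s) w = dist u w - s := by
  have h := hc.2.2 s hs _ ⟨dist_nonneg, le_rfl⟩
  rwa [hc.2.1, abs_sub_comm, abs_of_nonneg (sub_nonneg.2 hs.2)] at h

lemma dist_le_half_perimeter (p u w : X) : dist u w ≤ (dist p u + dist p w + dist u w) / 2 := by
  linarith [dist_triangle_left u w p]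

/-- The average of the two routes from `p` through `u` and through `w`. This keeps the distance in
the domain where `C` is monotone. -/
lemma IsGeodesicPath.dist_le_half_perimeter {c : ℝ → X} {u w : X} (hc : IsGeodesicPath c u w)
    {s : ℝ} (hs : s ∈ Set.Icc 0 (dist u w)) (p : X) :
    dist p (c s) ≤ (dist p u + dist p w + dist u w) / 2 := by
  have h1 := dist_triangle p u (c s)
  have h2 := dist_triangle_right p (c s) w
  rw [hc.dist_left hs] at h1
  rw [hc.dist_right hs] at h2
  linarith

/-- The comparison of the vertex `p` with a point of the opposite side, followed by `C` and the
weight `S`, is bounded by Stewart's equality in the model plane. -/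
lemma ModelPlane.stewartInequality (m : ModelPlane κ M ρ)
    (hgeo : ∀ x y : X, BelowModelDiam κ (dist x y) → ∃ c : ℝ → X, IsGeodesicPath c x y)
    (hX : TriangleComparison X κ M ρ) : m.StewartInequality X := by
  intro p u w c s hc hs hper
  obtain ⟨c₀, hc₀⟩ := hgeo p u (hper.mono (by linarith [dist_triangle_right p u w]))
  obtain ⟨c₂, hc₂⟩ := hgeo w p (hper.mono (by
    linarith [dist_triangle w u p, dist_comm w p, dist_comm w u, dist_comm u p]))
  obtain ⟨p', u', w', hpu, huw, hwp⟩ := m.exists_triangle (dist p u) (dist u w) (dist w p)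
    (by linarith [dist_triangle_right p u w, dist_comm w p])
    (by linarith [dist_triangle_left u w p, dist_comm w p])
    (by linarith [dist_triangle p u w, dist_comm w p])
    (hper.mono (by linarith [dist_comm w p]))
  have hbl : BelowModelDiam κ (ρ u' w') := by
    rw [huw]; exact hper.mono (QIConv.dist_le_half_perimeter p u w)
  obtain ⟨z', huz, hzw⟩ := m.exists_between u' w' s hbl hs.1 (huw ▸ hs.2)
  have hcomp := hX ![p, u, w] ![c₀, c, c₂]
    (by intro i; fin_cases i <;> assumption)
    (by
      refine hper.mono (le_of_eq ?_)
      simp only [Fin.sum_univ_three]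
      change (dist p u + dist u w + dist w p) / 2 = _
      rw [dist_comm w p]; ring)
    ![p', u', w'] (by intro i; fin_cases i <;> assumption)
    0 1 p ⟨0, ⟨le_rfl, dist_nonneg⟩, hc₀.1⟩ (c s) ⟨s, hs, rfl⟩ p' z'
    (by change ρ p' p' = dist p p; rw [m.rho_dist_self, dist_self]) hpu
    (by change ρ u' z' = dist u (c s); rw [huz, hc.dist_left hs])
    (by change ρ z' w' = dist (c s) w; rw [hzw, hc.dist_right hs, huw])
  have hst := m.stewart p' u' w' z' hbl (by rw [huz, hzw]; ring)
  rw [huz, hzw, huw, hpu, m.rho_dist_comm p' w', hwp, dist_comm w p] at hst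
  refine le_trans ?_ hst.le
  refine mul_le_mul_of_nonneg_left ?_ (m.S_nonneg dist_nonneg (huw ▸ hbl))
  exact m.strictMonoOn_C.monotoneOn
    (mem_domain dist_nonneg (hper.mono (hc.dist_le_half_perimeter hs p)))
    ⟨m.rho_dist_nonneg _ _, m.rho_dist_le _ _⟩ hcomp

/-- The comparison of a point with a point of the opposite side. -/
lemma ModelPlane.dist_le_of_stewartInequality (m : ModelPlane κ M ρ)
    (hX : m.StewartInequality X) {p u w : X} {c : ℝ → X} {s : ℝ} (hc : IsGeodesicPath c u w)
    (hs : s ∈ Set.Icc 0 (dist u w))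
    (hper : BelowModelDiam κ ((dist p u + dist p w + dist u w) / 2)) {p' u' w' z' : M}
    (hpu : dist p u ≤ ρ p' u') (hpw : dist p w ≤ ρ p' w') (huw : ρ u' w' = dist u w)
    (huz : ρ u' z' = s) (hzw : ρ z' w' = dist u w - s) : dist p (c s) ≤ ρ p' z' := by
  have hbl := hper.mono (QIConv.dist_le_half_perimeter p u w)
  have hmono {a b : X} {a' b' : M} (hab : BelowModelDiam κ (dist a b))
      (h : dist a b ≤ ρ a' b') : m.C (dist a b) ≤ m.C (ρ a' b') :=
    m.strictMonoOn_C.monotoneOn (mem_domain dist_nonneg hab)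
      ⟨m.rho_dist_nonneg _ _, m.rho_dist_le _ _⟩ h
  -- For a degenerate side the factor `S 0 = 0` cannot be cancelled; there the triangle inequality
  -- in the model suffices.
  rcases (dist_nonneg (x := u) (y := w)).eq_or_lt with h0 | hpos
  · have hs0 : s = 0 := le_antisymm (h0 ▸ hs.2) hs.1
    rw [hs0, hc.1]
    have h1 := m.rho_dist_triangle p' z' u'
    rw [m.rho_dist_comm z' u', huz, hs0, add_zero] at h1
    exact hpu.trans h1
  · have h1 := hX p u w c s hc hs hper
    have h2 := m.stewart p' u' w' z' (huw ▸ hbl) (by rw [huz, hzw, huw]; ring)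
    rw [huz, hzw, huw] at h2
    have h3 : m.S (dist u w) * m.C (dist p (c s)) ≤ m.S (dist u w) * m.C (ρ p' z') := by
      rw [h2]
      refine h1.trans (sub_le_sub_right (add_le_add ?_ ?_) _)
      · refine mul_le_mul_of_nonneg_left (hmono (hper.mono ?_) hpu)
          (m.S_nonneg (sub_nonneg.2 hs.2) (hbl.mono (by linarith [hs.1])))
        linarith [dist_triangle_right p u w]
      · refine mul_le_mul_of_nonneg_left (hmono (hper.mono ?_) hpw)
          (m.S_nonneg hs.1 (hbl.mono hs.2))
        linarith [dist_triangle p u w]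
    have h4 := le_of_mul_le_mul_left h3 (m.S_pos _ hpos hbl)
    exact (m.strictMonoOn_C.le_iff_le
      (mem_domain dist_nonneg (hper.mono (hc.dist_le_half_perimeter hs p)))
      ⟨m.rho_dist_nonneg _ _, m.rho_dist_le _ _⟩).1 h4

/-- The comparison of points on consecutive sides of a triangle. -/
lemma ModelPlane.dist_le_of_consecutive_sides (m : ModelPlane κ M ρ)
    (hX : m.StewartInequality X) {p u w : X} {c d : ℝ → X} {s t : ℝ}
    (hc : IsGeodesicPath c p u) (hs : s ∈ Set.Icc 0 (dist p u))
    (hd : IsGeodesicPath d u w) (ht : t ∈ Set.Icc 0 (dist u w))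
    (hper : BelowModelDiam κ ((dist p u + dist u w + dist w p) / 2)) {p' u' w' x' y' : M}
    (hpu : ρ p' u' = dist p u) (huw : ρ u' w' = dist u w) (hwp : ρ w' p' = dist w p)
    (hpx : ρ p' x' = s) (hxu : ρ x' u' = dist p u - s)
    (huy : ρ u' y' = t) (hyw : ρ y' w' = dist u w - t) : dist (c s) (d t) ≤ ρ x' y' := by
  -- First `w` is compared with `c s`, then `c s` with `d t` in the triangle on `c s, u, w`. The
  -- points `x', u', w'` need not form a comparison triangle of it, since `ρ w' x'` may be too
  -- large; this is why the preceding lemma asks only for inequalities.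
  have h1 : dist w (c s) ≤ ρ w' x' :=
    m.dist_le_of_stewartInequality hX hc hs (hper.mono (by linarith [dist_comm w u]))
      hwp.ge (by rw [m.rho_dist_comm, huw, dist_comm]) hpu hpx hxu
  refine m.dist_le_of_stewartInequality hX hd ht (hper.mono ?_)
    (by rw [hxu, hc.dist_right hs]) (by rw [m.rho_dist_comm, dist_comm]; exact h1) huw huy hyw
  have h2 := dist_triangle_left (c s) w p
  rw [hc.dist_left hs] at h2
  rw [hc.dist_right hs]
  linarith [dist_comm w p]

/-- Two sides of a triangle are equal or cyclically consecutive. On one side the triangle inequality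
in the model suffices, with no uniqueness of comparison points. -/
lemma ModelPlane.triangleComparison (m : ModelPlane κ M ρ) (hX : m.StewartInequality X) :
    TriangleComparison X κ M ρ := by
  intro v c hc hper v' hv' i j
  have key (i : Fin 3) (x : X) (hx : x ∈ c i '' Set.Icc 0 (dist (v i) (v (i + 1)))) (y : X)
      (hy : y ∈ c (i + 1) '' Set.Icc 0 (dist (v (i + 1)) (v (i + 1 + 1)))) (x' y' : M)
      (hx1 : ρ (v' i) x' = dist (v i) x) (hx2 : ρ x' (v' (i + 1)) = dist x (v (i + 1)))
      (hy1 : ρ (v' (i + 1)) y' = dist (v (i + 1)) y)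
      (hy2 : ρ y' (v' (i + 1 + 1)) = dist y (v (i + 1 + 1))) : dist x y ≤ ρ x' y' := by
    obtain ⟨s, hs, rfl⟩ := hx
    obtain ⟨t, ht, rfl⟩ := hy
    rw [(hc _).dist_left hs] at hx1
    rw [(hc _).dist_right hs] at hx2
    rw [(hc _).dist_left ht] at hy1
    rw [(hc _).dist_right ht] at hy2
    have h3 : i + 1 + 1 + 1 = i := by clear * -; revert i; decide
    have hcl := hv' (i + 1 + 1)
    rw [h3] at hcl
    refine m.dist_le_of_consecutive_sides hX (hc i) hs (hc (i + 1)) ht (hper.mono (le_of_eq ?_))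
      (hv' i) (hv' (i + 1)) hcl hx1 hx2 hy1 hy2
    rw [Fin.sum_univ_three]
    fin_cases i
    · rfl
    · change (dist (v 1) (v 2) + dist (v 2) (v 0) + dist (v 0) (v 1)) / 2 =
        (dist (v 0) (v 1) + dist (v 1) (v 2) + dist (v 2) (v 0)) / 2
      ring
    · change (dist (v 2) (v 0) + dist (v 0) (v 1) + dist (v 1) (v 2)) / 2 =
        (dist (v 0) (v 1) + dist (v 1) (v 2) + dist (v 2) (v 0)) / 2
      ring
  have hij : j = i ∨ j = i + 1 ∨ i = j + 1 := by clear * -; revert i j; decide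
  intro x hx y hy x' y' hx1 hx2 hy1 hy2
  rcases hij with rfl | rfl | rfl
  · obtain ⟨s, hs, rfl⟩ := hx
    obtain ⟨t, ht, rfl⟩ := hy
    rw [(hc _).dist_left hs] at hx1
    rw [(hc _).dist_left ht] at hy1
    rw [(hc _).2.2 s hs t ht, abs_le]
    have h1 := m.rho_dist_triangle (v' j) x' y'
    have h2 := m.rho_dist_triangle (v' j) y' x'
    rw [m.rho_dist_comm y' x'] at h2
    constructor <;> linarith
  · exact key _ x hx y hy x' y' hx1 hx2 hy1 hy2
  · rw [dist_comm, m.rho_dist_comm]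
    exact key _ y hy x hx y' x' hy1 hy2 hx1 hx2

end Model

/-! ### Stewart's inequality and geodesics in the limit -/

namespace QIApproximation

variable {X : ℕ → Type*} [∀ n, MetricSpace (X n)] {Y : Type*} [MetricSpace Y]
  (A : QIApproximation X Y) {κ : ℝ} (m : ModelTrig κ)

lemma tendsto_min_dist {x y : Y} {s : ℝ} (hs : s ∈ Set.Icc 0 (dist x y)) :
    Tendsto (fun n => min s (dist (A.g n x) (A.g n y))) atTop (𝓝 s) := by
  have h := (tendsto_const_nhds (x := s)).min (A.tendsto_dist_g x y)
  rwa [min_eq_left hs.2] at h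

lemma tendsto_half_perimeter (p u w : Y) :
    Tendsto (fun n => (dist (A.g n p) (A.g n u) + dist (A.g n p) (A.g n w) +
      dist (A.g n u) (A.g n w)) / 2) atTop (𝓝 ((dist p u + dist p w + dist u w) / 2)) :=
  (((A.tendsto_dist_g p u).add (A.tendsto_dist_g p w)).add (A.tendsto_dist_g u w)).div_const 2

lemma eventually_exists_geodesic
    (hX : ∀ n, ∀ a b : X n, BelowModelDiam κ (dist a b) → ∃ c : ℝ → X n, IsGeodesicPath c a b)
    {x y : Y} (hxy : BelowModelDiam κ (dist x y)) :
    ∃ c : ∀ n, ℝ → X n, ∀ᶠ n in atTop, IsGeodesicPath (c n) (A.g n x) (A.g n y) := by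
  have h (n : ℕ) : ∃ c : ℝ → X n, BelowModelDiam κ (dist (A.g n x) (A.g n y)) →
      IsGeodesicPath c (A.g n x) (A.g n y) := by
    by_cases hn : BelowModelDiam κ (dist (A.g n x) (A.g n y))
    · obtain ⟨c, hc⟩ := hX n _ _ hn
      exact ⟨c, fun _ => hc⟩
    · exact ⟨fun _ => A.g n x, fun h => (hn h).elim⟩
  choose c hc using h
  exact ⟨c, (hxy.eventually (A.tendsto_dist_g x y)).mono hc⟩

/-- A point that nearly satisfies the equalities for a point of a geodesic is near to the points
of the approximate geodesics. -/
lemma eventually_dist_geodesic_lt (hX : ∀ n, m.StewartInequality (X n)) {x y : Y}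
    {c : ∀ n, ℝ → X n} (hc : ∀ᶠ n in atTop, IsGeodesicPath (c n) (A.g n x) (A.g n y))
    (hpos : 0 < dist x y) {s : ℝ} (hs : s ∈ Set.Icc 0 (dist x y)) {q : Y}
    (hper : BelowModelDiam κ ((dist q x + dist q y + dist x y) / 2)) {ε : ℝ} (hε : 0 < ε)
    (hεκ : BelowModelDiam κ ε)
    (hq : m.bound (dist x y) s (dist q x) (dist q y) < m.S (dist x y) * m.C ε) :
    ∀ᶠ n in atTop, dist (A.g n q) (c n (min s (dist (A.g n x) (A.g n y)))) < ε := by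
  have hl := A.tendsto_dist_g x y
  have hS : Tendsto (fun n => m.S (dist (A.g n x) (A.g n y))) atTop (𝓝 (m.S (dist x y))) :=
    (m.continuous_S.tendsto _).comp hl
  filter_upwards [hc, hl.eventually_const_lt hpos,
    hper.eventually (A.tendsto_half_perimeter q x y),
    (m.tendsto_bound hl (A.tendsto_min_dist hs) (A.tendsto_dist_g q x)
      (A.tendsto_dist_g q y)).eventually_lt (hS.mul_const (m.C ε)) hq] with n hcn hpn hpern hn
  have hmem : min s (dist (A.g n x) (A.g n y)) ∈ Set.Icc 0 (dist (A.g n x) (A.g n y)) :=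
    ⟨le_min hs.1 dist_nonneg, min_le_right _ _⟩
  have h1 := (hX n (A.g n q) _ _ _ _ hcn hmem hpern).trans_lt hn
  have h2 := lt_of_mul_lt_mul_left h1
    (m.S_pos _ hpn (hpern.mono (dist_le_half_perimeter _ _ _))).le
  exact (m.strictMonoOn_C.lt_iff_lt
    (mem_domain dist_nonneg (hpern.mono (hcn.dist_le_half_perimeter hmem _)))
    (mem_domain hε.le hεκ)).1 h2

-- By rigidity, `g n (c s)` is close to the point with cut-off parameter `s` on a geodesic of `X n`,
-- whatever geodesic `c` of `Y` is given; the inequality of `X n` at that point passes to the limit.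
include A in
lemma stewartInequality (hX : ∀ n, m.StewartInequality (X n))
    (hgeo : ∀ n, ∀ a b : X n, BelowModelDiam κ (dist a b) →
      ∃ c : ℝ → X n, IsGeodesicPath c a b) : m.StewartInequality Y := by
  intro p u w c s hc hs hper
  rcases (dist_nonneg (x := u) (y := w)).eq_or_lt with h0 | hpos
  · have hs0 : s = 0 := le_antisymm (h0 ▸ hs.2) hs.1
    rw [ModelTrig.bound, ← h0, hs0, sub_zero, m.S_zero, m.K_zero]
    simp
  have hbl := hper.mono (dist_le_half_perimeter p u w)
  obtain ⟨c', hc'⟩ := A.eventually_exists_geodesic hgeo hbl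
  have hclose : Tendsto (fun n => dist (A.g n (c s))
      (c' n (min s (dist (A.g n u) (A.g n w))))) atTop (𝓝 0) := by
    refine tendsto_order.2 ⟨fun a ha => .of_forall fun n => ha.trans_le dist_nonneg,
      fun ε hε => ?_⟩
    -- The minimum with `dist u w` keeps the tolerance below `D_κ`.
    have hε' : 0 < min ε (dist u w) := lt_min hε hpos
    have hεκ : BelowModelDiam κ (min ε (dist u w)) := hbl.mono (min_le_right _ _)
    have hl : dist (c s) u = s := by rw [dist_comm, hc.dist_left hs]
    refine (A.eventually_dist_geodesic_lt m hX hc' hpos hs (q := c s) ?_ hε' hεκ ?_).mono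
      fun n hn => hn.trans_le (min_le_left _ _)
    · rw [hl, hc.dist_right hs]
      exact hbl.mono (by linarith)
    · rw [hl, hc.dist_right hs]
      exact m.bound_lt hpos hbl hε' hεκ
  have hdist : Tendsto (fun n => dist (A.g n p) (c' n (min s (dist (A.g n u) (A.g n w)))))
      atTop (𝓝 (dist p (c s))) := by
    refine tendsto_of_tendsto_of_dist (A.tendsto_dist_g p (c s))
      (squeeze_zero (fun _ => dist_nonneg) (fun n => ?_) hclose)
    rw [Real.dist_eq]
    simpa [dist_comm] using abs_dist_sub_le (A.g n (c s))
      (c' n (min s (dist (A.g n u) (A.g n w)))) (A.g n p)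
  have hl := A.tendsto_dist_g u w
  refine le_of_tendsto_of_tendsto (((m.continuous_S.tendsto _).comp hl).mul
    ((m.continuous_C.tendsto _).comp hdist))
    (m.tendsto_bound hl (A.tendsto_min_dist hs) (A.tendsto_dist_g p u) (A.tendsto_dist_g p w)) ?_
  filter_upwards [hc', hper.eventually (A.tendsto_half_perimeter p u w)] with n hcn hpern
  exact hX n _ _ _ _ _ hcn ⟨le_min hs.1 dist_nonneg, min_le_right _ _⟩ hpern

-- For large `k` and `l`, the points `q k` and `q l` nearly satisfy the distance equalities of a
-- geodesic point. Rigidity puts `g n (q k)` and `g n (q l)` near the same point of `X n` for all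
-- large `n`, and letting `n` tend to infinity bounds `dist (q k) (q l)`.
include A in
lemma exists_geodesic [CompleteSpace Y] (hX : ∀ n, m.StewartInequality (X n))
    (hgeo : ∀ n, ∀ a b : X n, BelowModelDiam κ (dist a b) →
      ∃ c : ℝ → X n, IsGeodesicPath c a b) (x y : Y) (hxy : BelowModelDiam κ (dist x y)) :
    ∃ c : ℝ → Y, IsGeodesicPath c x y := by
  rcases (dist_nonneg (x := x) (y := y)).eq_or_lt with h0 | hpos
  · obtain rfl := dist_eq_zero.1 h0.symm
    refine ⟨fun _ => x, rfl, rfl, fun s hs t ht => ?_⟩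
    rw [dist_self] at hs ht ⊢
    rw [le_antisymm hs.2 hs.1, le_antisymm ht.2 ht.1, sub_zero, abs_zero]
  obtain ⟨c, hc⟩ := A.eventually_exists_geodesic hgeo hxy
  refine A.exists_isGeodesicPath hc le_rfl fun s hs => cauchySeq_tendsto_of_complete ?_
  have hx := A.tendsto_dist_f_of_tendsto_dist_g (A.tendsto_dist_geodesic_source hc hs)
  have hy := A.tendsto_dist_f_of_tendsto_dist_g (A.tendsto_dist_geodesic_target hc hs)
  set q : ℕ → Y := fun n => A.f n (c n (min s (dist (A.g n x) (A.g n y))))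
  refine Metric.cauchySeq_iff.2 fun ε hε => ?_
  set η := min (ε / 3) (dist x y)
  have hη : 0 < η := lt_min (by positivity) hpos
  have hηκ : BelowModelDiam κ η := hxy.mono (min_le_right _ _)
  have hper : Tendsto (fun n => (dist (q n) x + dist (q n) y + dist x y) / 2) atTop
      (𝓝 (dist x y)) := by
    have h := ((hx.add hy).add_const (dist x y)).div_const 2
    have hval : (s + (dist x y - s) + dist x y) / 2 = dist x y := by ring
    rwa [hval] at h
  have hev := (hxy.eventually hper).and ((m.tendsto_bound (tendsto_const_nhds (x := dist x y))
    (tendsto_const_nhds (x := s)) hx hy).eventually_lt_const (m.bound_lt hpos hxy hη hηκ))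
  obtain ⟨N, hN⟩ := eventually_atTop.1 hev
  refine ⟨N, fun k hk l hl => ?_⟩
  have hk' := A.eventually_dist_geodesic_lt m hX hc hpos hs (hN k hk).1 hη hηκ (hN k hk).2
  have hl' := A.eventually_dist_geodesic_lt m hX hc hpos hs (hN l hl).1 hη hηκ (hN l hl).2
  have hle : dist (q k) (q l) ≤ 2 * (ε / 3) := by
    refine le_of_tendsto (A.tendsto_dist_g (q k) (q l)) ?_
    filter_upwards [hk', hl'] with n h1 h2
    have h3 := dist_triangle_right (A.g n (q k)) (A.g n (q l))
      (c n (min s (dist (A.g n x) (A.g n y))))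
    have h4 : η ≤ ε / 3 := min_le_left _ _
    linarith
  linarith

include A in
lemma triangleComparison_and_geodesic {M : Type} {ρ : M → M → ℝ} (m : ModelPlane κ M ρ)
    (hX : ∀ n, TriangleComparison (X n) κ M ρ)
    (hgeo : ∀ n, ∀ a b : X n, BelowModelDiam κ (dist a b) →
      ∃ c : ℝ → X n, IsGeodesicPath c a b) :
    TriangleComparison Y κ M ρ ∧ (CompleteSpace Y → ∀ x y : Y, BelowModelDiam κ (dist x y) →
      ∃ c : ℝ → Y, IsGeodesicPath c x y) := by
  have hst (n : ℕ) : m.StewartInequality (X n) := m.stewartInequality (hgeo n) (hX n)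
  exact ⟨m.triangleComparison (A.stewartInequality m.toModelTrig hst hgeo),
    fun _ => A.exists_geodesic m.toModelTrig hst hgeo⟩

end QIApproximation

/-! ### The Euclidean plane -/

section Euclidean

local notation "E2" => EuclideanSpace ℝ (Fin 2)

lemma euclidean_dist_sq (x y : E2) : dist x y ^ 2 = (x 0 - y 0) ^ 2 + (x 1 - y 1) ^ 2 := by
  rw [EuclideanSpace.dist_eq, Real.sq_sqrt (by positivity), Fin.sum_univ_two, Real.dist_eq,
    Real.dist_eq, sq_abs, sq_abs]

/-- Equality in the triangle inequality makes the squared norm of `t • (u - z) + s • (w - z)`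
vanish, where `s` and `t` are the distances of `z` to `u` and `w`; the rest is expansion about `z`.
-/
lemma euclidean_stewart (p u w z : E2) (h : dist u z + dist z w = dist u w) :
    dist u w * dist p z ^ 2 = dist z w * dist p u ^ 2 + dist u z * dist p w ^ 2 -
      dist u z * dist z w * dist u w := by
  have huz := euclidean_dist_sq u z
  have hzw := euclidean_dist_sq z w
  have huw := euclidean_dist_sq u w
  rw [← h] at huw ⊢
  rw [euclidean_dist_sq p z, euclidean_dist_sq p u, euclidean_dist_sq p w]
  generalize dist u z = s at *
  generalize dist z w = t at *
  have hsum : (t * (u 0 - z 0) + s * (w 0 - z 0)) ^ 2 +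
      (t * (u 1 - z 1) + s * (w 1 - z 1)) ^ 2 = 0 := by
    linear_combination (-(t ^ 2 + s * t)) * huz - (s ^ 2 + s * t) * hzw + s * t * huw
  have h0 : t * (u 0 - z 0) + s * (w 0 - z 0) = 0 := by
    have := sq_nonneg (t * (u 0 - z 0) + s * (w 0 - z 0))
    have := sq_nonneg (t * (u 1 - z 1) + s * (w 1 - z 1))
    exact pow_eq_zero_iff two_ne_zero |>.1 (by linarith)
  have h1 : t * (u 1 - z 1) + s * (w 1 - z 1) = 0 := by
    have := sq_nonneg (t * (u 0 - z 0) + s * (w 0 - z 0))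
    have := sq_nonneg (t * (u 1 - z 1) + s * (w 1 - z 1))
    exact pow_eq_zero_iff two_ne_zero |>.1 (by linarith)
  linear_combination 2 * (p 0 - z 0) * h0 + 2 * (p 1 - z 1) * h1 + t * huz + s * hzw

lemma euclidean_exists_triangle {a b c : ℝ} (ha : a ≤ b + c) (hb : b ≤ a + c) (hc : c ≤ a + b) :
    ∃ p u w : E2, dist p u = a ∧ dist u w = b ∧ dist w p = c := by
  have ha0 : 0 ≤ a := by linarith
  have hb0 : 0 ≤ b := by linarith
  have hc0 : 0 ≤ c := by linarith
  -- The law of cosines gives the coordinate of `p` along the side from `u` to `w`; the triangle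
  -- inequalities give `x ^ 2 ≤ a ^ 2`.
  obtain ⟨x, hx1, hx2⟩ : ∃ x : ℝ, x ^ 2 ≤ a ^ 2 ∧ 2 * b * x = a ^ 2 + b ^ 2 - c ^ 2 := by
    rcases hb0.eq_or_lt with rfl | hb0
    · exact ⟨0, by simpa using sq_nonneg _, by rw [show a = c by linarith]; ring⟩
    · refine ⟨(a ^ 2 + b ^ 2 - c ^ 2) / (2 * b), ?_, by field_simp⟩
      rw [sq_le_sq, abs_of_nonneg ha0, abs_div, abs_of_pos (show 0 < 2 * b by positivity),
        div_le_iff₀ (by positivity), abs_le]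
      constructor <;> nlinarith
  have hy : √(a ^ 2 - x ^ 2) ^ 2 = a ^ 2 - x ^ 2 := Real.sq_sqrt (by linarith)
  refine ⟨!₂[x, √(a ^ 2 - x ^ 2)], !₂[0, 0], !₂[b, 0], ?_, ?_, ?_⟩
  · rw [← sq_eq_sq₀ dist_nonneg ha0, euclidean_dist_sq]
    simp [hy]
  · rw [← sq_eq_sq₀ dist_nonneg hb0, euclidean_dist_sq]
    simp
  · rw [← sq_eq_sq₀ dist_nonneg hc0, euclidean_dist_sq]
    simp only [Matrix.cons_val_zero, Matrix.cons_val_one, zero_sub, neg_sq, hy]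
    linear_combination -hx2

/-- The Euclidean plane as a model plane. -/
def euclideanModel : ModelPlane 0 E2 dist where
  C t := t ^ 2
  S t := t
  K l s := s * (l - s) * l
  continuous_C := by fun_prop
  continuous_S := by fun_prop
  continuous_K := by fun_prop
  strictMonoOn_C := fun s hs t _ hst => pow_lt_pow_left₀ hst hs.1 two_ne_zero
  S_zero := rfl
  S_pos := fun t ht _ => ht
  collinear := fun l s => by ring
  rho_dist_self := dist_self
  rho_dist_comm := dist_comm
  rho_dist_triangle := dist_triangle
  rho_dist_nonneg := fun _ _ => dist_nonneg
  rho_dist_le := fun _ _ h => (lt_irrefl _ h).elim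
  stewart := fun p u w z _ h => by
    rw [euclidean_stewart p u w z h, ← h]
    ring
  exists_between := fun u w s _ hs hsl => by
    rcases (dist_nonneg (x := u) (y := w)).eq_or_lt with h0 | hpos
    · exact ⟨u, by rw [dist_self]; linarith, by linarith⟩
    · refine ⟨AffineMap.lineMap u w (s / dist u w), ?_, ?_⟩
      · rw [dist_left_lineMap, Real.norm_of_nonneg (by positivity)]
        field_simp
      · rw [dist_lineMap_right, Real.norm_of_nonneg
          (sub_nonneg.2 ((div_le_one hpos).2 hsl))]
        field_simp
  exists_triangle := fun _ _ _ ha hb hc _ => euclidean_exists_triangle ha hb hc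

end Euclidean

/-! ### The spheres -/

section Sphere

open InnerProductGeometry

local notation "E3" => EuclideanSpace ℝ (Fin 3)
local notation "S2" => Metric.sphere (0 : EuclideanSpace ℝ (Fin 3)) 1

lemma norm_sphere (x : S2) : ‖(x : E3)‖ = 1 := by simp

lemma inner_sphere (x y : S2) : inner ℝ (x : E3) (y : E3) = Real.cos (angle (x : E3) (y : E3)) :=
  inner_eq_cos_angle_of_norm_eq_one (norm_sphere x) (norm_sphere y)

lemma angle_sphere_eq {x y : S2} {t : ℝ} (h0 : 0 ≤ t) (hπ : t ≤ Real.pi)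
    (h : inner ℝ (x : E3) (y : E3) = Real.cos t) : angle (x : E3) (y : E3) = t := by
  rw [inner_sphere] at h
  exact Real.injOn_cos ⟨angle_nonneg _ _, angle_le_pi _ _⟩ ⟨h0, hπ⟩ h

lemma angle_sphere_self (x : S2) : angle (x : E3) (x : E3) = 0 :=
  angle_self (norm_ne_zero_iff.1 (by rw [norm_sphere]; exact one_ne_zero))

lemma real_inner_sphere_self (x : S2) : inner ℝ (x : E3) (x : E3) = 1 := by
  rw [real_inner_self_eq_norm_sq, norm_sphere, one_pow]

/-- Since `z` is between `u` and `w`, the vector `sin (s + t) • z - sin t • u - sin s • w` has norm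
zero; its inner product with `p` is the claim. -/
lemma sphere_stewart (p u w z : S2) (h : angle (u : E3) z + angle (z : E3) w = angle (u : E3) w) :
    Real.sin (angle (u : E3) w) * Real.cos (angle (p : E3) z) =
      Real.sin (angle (z : E3) w) * Real.cos (angle (p : E3) u) +
      Real.sin (angle (u : E3) z) * Real.cos (angle (p : E3) w) := by
  have huz := inner_sphere u z
  have hzw := inner_sphere z w
  have huw := inner_sphere u w
  rw [← inner_sphere p z, ← inner_sphere p u, ← inner_sphere p w]
  rw [← h] at huw ⊢
  generalize angle (u : E3) z = s at *
  generalize angle (z : E3) w = t at *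
  have hzero : Real.sin (s + t) • (z : E3) - Real.sin t • (u : E3) - Real.sin s • (w : E3) = 0 := by
    rw [← inner_self_eq_zero (𝕜 := ℝ)]
    have hzu := (real_inner_comm (u : E3) (z : E3)).trans huz
    have hwz := (real_inner_comm (z : E3) (w : E3)).trans hzw
    have hwu := (real_inner_comm (u : E3) (w : E3)).trans huw
    simp only [inner_sub_left, inner_sub_right, real_inner_smul_left, real_inner_smul_right,
      real_inner_sphere_self, huz, hzu, hzw, hwz, huw, hwu, Real.sin_add, Real.cos_add]
    have hs := Real.sin_sq_add_cos_sq s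
    have ht := Real.sin_sq_add_cos_sq t
    generalize Real.sin s = a at *
    generalize Real.cos s = b at *
    generalize Real.sin t = c at *
    generalize Real.cos t = d at *
    linear_combination (-c ^ 2) * hs - a ^ 2 * ht
  have hp := congrArg (inner ℝ (p : E3)) hzero
  simp only [inner_sub_right, real_inner_smul_right, inner_zero_right] at hp
  linarith

lemma sphere_exists_between (u w : S2) {s : ℝ} (huw : angle (u : E3) w < Real.pi) (hs : 0 ≤ s)
    (hsl : s ≤ angle (u : E3) w) :
    ∃ z : S2, angle (u : E3) z = s ∧ angle (z : E3) w = angle (u : E3) w - s := by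
  have hin := inner_sphere u w
  rcases (angle_nonneg (u : E3) w).eq_or_lt with h0 | hpos
  · have hs0 : s = 0 := le_antisymm (h0 ▸ hsl) hs
    exact ⟨u, by rw [angle_sphere_self, hs0], by rw [hs0, sub_zero]⟩
  have hsin : 0 < Real.sin (angle (u : E3) w) := Real.sin_pos_of_pos_of_lt_pi hpos huw
  obtain ⟨t, ht⟩ : ∃ t, angle (u : E3) w = s + t := ⟨angle (u : E3) w - s, by ring⟩
  have hu := real_inner_sphere_self u
  have hw := real_inner_sphere_self w
  rw [ht] at hin hsin hsl huw ⊢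
  rw [add_sub_cancel_left]
  have ht0 : 0 ≤ t := by linarith
  have hsq := Real.sin_sq_add_cos_sq s
  have htq := Real.sin_sq_add_cos_sq t
  set v : E3 := (Real.sin (s + t))⁻¹ • (Real.sin t • (u : E3) + Real.sin s • (w : E3)) with hv
  have hvu : inner ℝ (u : E3) v = Real.cos s := by
    simp only [hv, inner_add_right, real_inner_smul_right, hu, hin]
    rw [inv_mul_eq_iff_eq_mul₀ hsin.ne', Real.sin_add, Real.cos_add]
    linear_combination (-Real.sin t) * hsq
  have hvw : inner ℝ v (w : E3) = Real.cos t := by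
    simp only [hv, inner_add_left, real_inner_smul_left, hw, hin]
    rw [inv_mul_eq_iff_eq_mul₀ hsin.ne', Real.sin_add, Real.cos_add]
    linear_combination (-Real.sin s) * htq
  have hvv : inner ℝ v v = 1 := by
    conv_lhs => rw [hv]
    rw [real_inner_smul_left, inner_add_left, real_inner_smul_left, real_inner_smul_left, hvu,
      real_inner_comm, hvw, inv_mul_eq_iff_eq_mul₀ hsin.ne', Real.sin_add]
    ring
  have hnorm : ‖v‖ = 1 := by
    rw [real_inner_self_eq_norm_sq] at hvv
    exact (pow_eq_one_iff_of_nonneg (norm_nonneg _) two_ne_zero).1 hvv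
  let z : S2 := ⟨v, by simpa using hnorm⟩
  refine ⟨z, angle_sphere_eq hs (by linarith) hvu, angle_sphere_eq ht0 (by linarith) hvw⟩

/-- The spherical law of cosines determines the second coordinate `x` of `p`. The bound `|x| ≤ sin
a` amounts to `cos (a + b) ≤ cos c ≤ cos (a - b)`; if `a + b` exceeds `π`, the first inequality
rests on the perimeter bound. -/
lemma sphere_exists_triangle {a b c : ℝ} (ha : a ≤ b + c) (hb : b ≤ a + c) (hc : c ≤ a + b)
    (hper : a + b + c < 2 * Real.pi) :
    ∃ p u w : S2, angle (p : E3) u = a ∧ angle (u : E3) w = b ∧ angle (w : E3) p = c := by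
  have ha0 : 0 ≤ a := by linarith
  have hb0 : 0 ≤ b := by linarith
  have hc0 : 0 ≤ c := by linarith
  have haπ : a ≤ Real.pi := by linarith
  have hbπ : b < Real.pi := by linarith
  have hcπ : c ≤ Real.pi := by linarith
  have hle1 : Real.cos (a + b) ≤ Real.cos c := by
    rcases le_total (a + b) Real.pi with h | h
    · exact Real.cos_le_cos_of_nonneg_of_le_pi hc0 h hc
    · rw [← Real.cos_two_pi_sub]
      exact Real.cos_le_cos_of_nonneg_of_le_pi hc0 (by linarith) (by linarith)
  have hle2 : Real.cos c ≤ Real.cos (a - b) := by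
    rw [← Real.cos_abs (a - b)]
    exact Real.cos_le_cos_of_nonneg_of_le_pi (abs_nonneg _) hcπ
      (abs_le.2 ⟨by linarith, by linarith⟩)
  rw [Real.cos_add] at hle1
  rw [Real.cos_sub] at hle2
  have hsa : 0 ≤ Real.sin a := Real.sin_nonneg_of_nonneg_of_le_pi ha0 haπ
  obtain ⟨x, hx1, hx2⟩ : ∃ x : ℝ, x ^ 2 ≤ Real.sin a ^ 2 ∧
      Real.cos b * Real.cos a + Real.sin b * x = Real.cos c := by
    rcases hb0.eq_or_lt with rfl | hb0
    · exact ⟨0, by simpa using sq_nonneg _, by rw [show a = c by linarith]; simp⟩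
    · have hsb := Real.sin_pos_of_pos_of_lt_pi hb0 hbπ
      refine ⟨(Real.cos c - Real.cos b * Real.cos a) / Real.sin b, ?_, by field_simp; ring⟩
      rw [sq_le_sq, abs_of_nonneg hsa, abs_div, abs_of_pos hsb, div_le_iff₀ hsb, abs_le]
      constructor <;> linarith
  have hy : √(Real.sin a ^ 2 - x ^ 2) ^ 2 = Real.sin a ^ 2 - x ^ 2 :=
    Real.sq_sqrt (by linarith)
  have hqa := Real.sin_sq_add_cos_sq a
  have hqb := Real.sin_sq_add_cos_sq b
  have hmem {q0 q1 q2 : ℝ} (h : q0 ^ 2 + q1 ^ 2 + q2 ^ 2 = 1) : !₂[q0, q1, q2] ∈ S2 := by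
    rw [mem_sphere_zero_iff_norm, EuclideanSpace.norm_eq, Fin.sum_univ_three]
    simp [h]
  have hinner (q0 q1 q2 q0' q1' q2' : ℝ) : inner ℝ (!₂[q0, q1, q2] : E3) !₂[q0', q1', q2'] =
      q0 * q0' + q1 * q1' + q2 * q2' := by
    simp [PiLp.inner_apply, Fin.sum_univ_three, mul_comm]
  let p : S2 := ⟨!₂[Real.cos a, x, √(Real.sin a ^ 2 - x ^ 2)],
    hmem (by rw [hy]; linarith)⟩
  let u : S2 := ⟨!₂[1, 0, 0], hmem (by norm_num)⟩
  let w : S2 := ⟨!₂[Real.cos b, Real.sin b, 0], hmem (by linarith)⟩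
  refine ⟨p, u, w, angle_sphere_eq ha0 haπ ?_, angle_sphere_eq hb0 hbπ.le ?_,
    angle_sphere_eq hc0 hcπ ?_⟩
  · simp only [p, u, hinner]
    ring
  · simp only [u, w, hinner]
    ring
  · simp only [w, p, hinner]
    linarith

/-- The sphere of curvature `κ > 0` as a model plane. -/
def sphereModel {κ : ℝ} (hκ : 0 < κ) : ModelPlane κ S2 (sphereDist κ) where
  -- The sign makes `C` increasing.
  C t := -Real.cos (√κ * t)
  S t := Real.sin (√κ * t)
  K _ _ := 0
  continuous_C := by fun_prop
  continuous_S := by fun_prop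
  continuous_K := by fun_prop
  strictMonoOn_C := fun s hs t ht hst => by
    have hk : 0 < √κ := Real.sqrt_pos.2 hκ
    have h0 := hs.1
    have hπ := (le_div_iff₀ hk).1 (ht.2 hκ)
    refine neg_lt_neg (Real.cos_lt_cos_of_nonneg_of_le_pi (by positivity) (by linarith) ?_)
    gcongr
  S_zero := by simp
  S_pos := fun t ht h => by
    have hk : 0 < √κ := Real.sqrt_pos.2 hκ
    have hπ := (lt_div_iff₀ hk).1 (h hκ)
    exact Real.sin_pos_of_pos_of_lt_pi (by positivity) (by linarith)
  collinear := fun l s => by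
    have h : √κ * l = √κ * s + √κ * (l - s) := by ring
    rw [h, Real.sin_add, mul_zero, Real.cos_zero]
    ring
  rho_dist_self := fun x => by rw [sphereDist, angle_sphere_self, zero_div]
  rho_dist_comm := fun x y => by rw [sphereDist, angle_comm, sphereDist]
  rho_dist_triangle := fun x y z => by
    rw [sphereDist, sphereDist, sphereDist, ← add_div]
    gcongr
    exact angle_le_angle_add_angle _ _ _
  rho_dist_nonneg := fun x y => div_nonneg (angle_nonneg _ _) (Real.sqrt_nonneg _)
  rho_dist_le := fun x y _ => by
    rw [sphereDist]
    gcongr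
    exact angle_le_pi _ _
  stewart := fun p u w z _ h => by
    have hk : 0 < √κ := Real.sqrt_pos.2 hκ
    simp only [sphereDist, mul_div_cancel₀ _ hk.ne'] at h ⊢
    rw [← add_div, div_left_inj' hk.ne'] at h
    linear_combination -(sphere_stewart p u w z h)
  exists_between := fun u w s h hs hsl => by
    have hk : 0 < √κ := Real.sqrt_pos.2 hκ
    have hπ := h hκ
    rw [sphereDist] at hπ hsl
    obtain ⟨z, h1, h2⟩ := sphere_exists_between u w (s := s * √κ)
      ((div_lt_div_iff_of_pos_right hk).1 hπ) (by positivity) ((le_div_iff₀ hk).1 hsl)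
    refine ⟨z, ?_, ?_⟩
    · rw [sphereDist, h1]
      field_simp
    · rw [sphereDist, h2, sphereDist]
      field_simp
  exists_triangle := fun a b c ha hb hc hper => by
    have hk : 0 < √κ := Real.sqrt_pos.2 hκ
    have hπ := (lt_div_iff₀ hk).1 (hper hκ)
    obtain ⟨p, u, w, h1, h2, h3⟩ := sphere_exists_triangle
      (a := a * √κ) (b := b * √κ) (c := c * √κ) (by nlinarith) (by nlinarith) (by nlinarith)
      (by linarith)
    refine ⟨p, u, w, ?_, ?_, ?_⟩
    · rw [sphereDist, h1]; field_simp
    · rw [sphereDist, h2]; field_simp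
    · rw [sphereDist, h3]; field_simp

end Sphere

/-! ### The hyperbolic planes -/

section Hyperbolic

local notation "ℍ²" => UpperHalfPlane

/-- The time coordinate in the hyperboloid model. -/
def hypT (z : ℍ²) : ℝ := (z.re ^ 2 + z.im ^ 2 + 1) / (2 * z.im)

/-- The first space coordinate in the hyperboloid model. -/
def hypX (z : ℍ²) : ℝ := (z.re ^ 2 + z.im ^ 2 - 1) / (2 * z.im)

/-- The second space coordinate in the hyperboloid model. -/
def hypY (z : ℍ²) : ℝ := z.re / z.im

lemma cosh_dist_eq_hyp (z w : ℍ²) :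
    Real.cosh (dist z w) = hypT z * hypT w - hypX z * hypX w - hypY z * hypY w := by
  have hz := z.im_pos
  have hw := w.im_pos
  rw [UpperHalfPlane.cosh_dist', hypT, hypT, hypX, hypX, hypY, hypY]
  field_simp
  ring

lemma hyp_sq (z : ℍ²) : hypT z ^ 2 - hypX z ^ 2 - hypY z ^ 2 = 1 := by
  have h := cosh_dist_eq_hyp z z
  rw [dist_self, Real.cosh_zero] at h
  linarith

lemma hypT_pos (z : ℍ²) : 0 < hypT z := by
  have hz := z.im_pos
  rw [hypT]
  positivity

lemma exists_hyp {T X Y : ℝ} (hT : 0 < T) (h : T ^ 2 - X ^ 2 - Y ^ 2 = 1) :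
    ∃ z : ℍ², hypT z = T ∧ hypX z = X ∧ hypY z = Y := by
  have hTX : 0 < T - X := by nlinarith [sq_nonneg Y]
  -- In these coordinates `T - X` is the inverse of the imaginary part, and `Y` is the quotient of
  -- real and imaginary part.
  refine ⟨⟨⟨Y / (T - X), 1 / (T - X)⟩, by simpa using hTX⟩, ?_, ?_, ?_⟩
  · change ((Y / (T - X)) ^ 2 + (1 / (T - X)) ^ 2 + 1) / (2 * (1 / (T - X))) = T
    field_simp
    linear_combination -h
  · change ((Y / (T - X)) ^ 2 + (1 / (T - X)) ^ 2 - 1) / (2 * (1 / (T - X))) = X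
    field_simp
    linear_combination -h
  · change Y / (T - X) / (1 / (T - X)) = Y
    field_simp

lemma dist_eq_of_cosh_eq {z w : ℍ²} {t : ℝ} (ht : 0 ≤ t)
    (h : hypT z * hypT w - hypX z * hypX w - hypY z * hypY w = Real.cosh t) : dist z w = t := by
  rw [← cosh_dist_eq_hyp] at h
  exact Real.cosh_strictMonoOn.injOn dist_nonneg ht h

/-- A lightlike vector orthogonal to a timelike vector vanishes. -/
lemma eq_zero_of_lightlike_of_orthogonal {T X Y a b c : ℝ} (hT : T ^ 2 - X ^ 2 - Y ^ 2 = 1)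
    (h0 : a ^ 2 - b ^ 2 - c ^ 2 = 0) (h1 : a * T - b * X - c * Y = 0) :
    a = 0 ∧ b = 0 ∧ c = 0 := by
  -- Lagrange's identity for `(b, c)` and `(X, Y)`, with `b ^ 2 + c ^ 2 = a ^ 2` and `b * X + c * Y
  -- = a * T`.
  have h2 : (b * Y - c * X) ^ 2 + a ^ 2 = 0 := by
    linear_combination (-a ^ 2) * hT - (X ^ 2 + Y ^ 2) * h0 + (a * T + b * X + c * Y) * h1
  have ha : a = 0 := by
    have := sq_nonneg (b * Y - c * X)
    have := sq_nonneg a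
    exact pow_eq_zero_iff two_ne_zero |>.1 (by linarith)
  subst ha
  have hb := sq_nonneg b
  have hc := sq_nonneg c
  exact ⟨rfl, pow_eq_zero_iff two_ne_zero |>.1 (by linarith),
    pow_eq_zero_iff two_ne_zero |>.1 (by linarith)⟩

/-- As on the sphere, a linear relation holds between `z`, `u` and `w`, now in Minkowski space. The
form is indefinite, so the difference vector is shown to be lightlike and also orthogonal to the
timelike `z`. -/
lemma hyperbolic_stewart (p u w z : ℍ²) (h : dist u z + dist z w = dist u w) :
    Real.sinh (dist u w) * Real.cosh (dist p z) =
      Real.sinh (dist z w) * Real.cosh (dist p u) +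
      Real.sinh (dist u z) * Real.cosh (dist p w) := by
  have huz := cosh_dist_eq_hyp u z
  have hzw := cosh_dist_eq_hyp z w
  have huw := cosh_dist_eq_hyp u w
  rw [cosh_dist_eq_hyp p z, cosh_dist_eq_hyp p u, cosh_dist_eq_hyp p w]
  rw [← h] at huw ⊢
  have hu := hyp_sq u
  have hw := hyp_sq w
  have hz := hyp_sq z
  have hs := Real.cosh_sq (dist u z)
  have ht := Real.cosh_sq (dist z w)
  rw [Real.cosh_add] at huw
  rw [Real.sinh_add]
  generalize Real.sinh (dist u z) = a at *
  generalize Real.cosh (dist u z) = b at *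
  generalize Real.sinh (dist z w) = c at *
  generalize Real.cosh (dist z w) = d at *
  obtain ⟨h1, h2, h3⟩ := eq_zero_of_lightlike_of_orthogonal hz
    (a := (a * d + b * c) * hypT z - c * hypT u - a * hypT w)
    (b := (a * d + b * c) * hypX z - c * hypX u - a * hypX w)
    (c := (a * d + b * c) * hypY z - c * hypY u - a * hypY w)
    (by
      linear_combination (a * d + b * c) ^ 2 * hz + c ^ 2 * hu + a ^ 2 * hw +
        2 * (a * d + b * c) * c * huz + 2 * (a * d + b * c) * a * hzw - 2 * a * c * huw -
        c ^ 2 * hs - a ^ 2 * ht)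
    (by linear_combination (a * d + b * c) * hz + c * huz + a * hzw)
  linear_combination hypT p * h1 - hypX p * h2 - hypY p * h3

lemma hyperbolic_exists_between (u w : ℍ²) {s : ℝ} (hs : 0 ≤ s) (hsl : s ≤ dist u w) :
    ∃ z : ℍ², dist u z = s ∧ dist z w = dist u w - s := by
  rcases (dist_nonneg (x := u) (y := w)).eq_or_lt with h0 | hpos
  · exact ⟨u, by rw [dist_self]; linarith, by linarith⟩
  have huw := cosh_dist_eq_hyp u w
  have hsinh : 0 < Real.sinh (dist u w) := Real.sinh_pos_iff.2 hpos
  obtain ⟨t, ht⟩ : ∃ t, dist u w = s + t := ⟨dist u w - s, by ring⟩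
  rw [ht] at huw hsinh hsl hpos ⊢
  rw [add_sub_cancel_left]
  have ht0 : 0 ≤ t := by linarith
  have hu := hyp_sq u
  have hw := hyp_sq w
  have hsq := Real.cosh_sq s
  have htq := Real.cosh_sq t
  have hS := Real.sinh_nonneg_iff.2 hs
  have hT := Real.sinh_nonneg_iff.2 ht0
  have hadd := Real.sinh_add s t
  -- The combination must lie on the upper sheet of the hyperboloid.
  have hpos' : 0 < Real.sinh t * hypT u + Real.sinh s * hypT w := by
    have h1 := mul_nonneg hT (hypT_pos u).le
    have h2 := mul_nonneg hS (hypT_pos w).le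
    rcases hs.eq_or_lt with rfl | hs
    · have h3 := mul_pos (Real.sinh_pos_iff.2 (by linarith : 0 < t)) (hypT_pos u)
      linarith
    · have h3 := mul_pos (Real.sinh_pos_iff.2 hs) (hypT_pos w)
      linarith
  rw [Real.cosh_add] at huw
  obtain ⟨z, h1, h2, h3⟩ := exists_hyp
    (T := (Real.sinh t * hypT u + Real.sinh s * hypT w) / Real.sinh (s + t))
    (X := (Real.sinh t * hypX u + Real.sinh s * hypX w) / Real.sinh (s + t))
    (Y := (Real.sinh t * hypY u + Real.sinh s * hypY w) / Real.sinh (s + t))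
    (by positivity) (by
      rw [div_pow, div_pow, div_pow, ← sub_div, ← sub_div, div_eq_one_iff_eq (by positivity), hadd]
      linear_combination Real.sinh t ^ 2 * hu + Real.sinh s ^ 2 * hw -
        2 * Real.sinh s * Real.sinh t * huw - Real.sinh t ^ 2 * hsq - Real.sinh s ^ 2 * htq)
  refine ⟨z, dist_eq_of_cosh_eq hs ?_, dist_eq_of_cosh_eq ht0 ?_⟩
  · rw [h1, h2, h3, ← mul_div_assoc, ← mul_div_assoc, ← mul_div_assoc, ← sub_div, ← sub_div,
      div_eq_iff hsinh.ne', hadd]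
    linear_combination Real.sinh t * hu - Real.sinh s * huw - Real.sinh t * hsq
  · rw [h1, h2, h3, div_mul_eq_mul_div, div_mul_eq_mul_div, div_mul_eq_mul_div, ← sub_div,
      ← sub_div, div_eq_iff hsinh.ne', hadd]
    linear_combination Real.sinh s * hw - Real.sinh t * huw - Real.sinh s * htq

/-- The hyperbolic law of cosines places `p`, with `u` at the apex of the hyperboloid; monotonicity
of `cosh` and the triangle inequalities give `|x| ≤ sinh a`. -/
lemma hyperbolic_exists_triangle {a b c : ℝ} (ha : a ≤ b + c) (hb : b ≤ a + c) (hc : c ≤ a + b) :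
    ∃ p u w : ℍ², dist p u = a ∧ dist u w = b ∧ dist w p = c := by
  have ha0 : 0 ≤ a := by linarith
  have hb0 : 0 ≤ b := by linarith
  have hc0 : 0 ≤ c := by linarith
  have hle1 : Real.cosh c ≤ Real.cosh (a + b) :=
    Real.cosh_le_cosh.2 (by rwa [abs_of_nonneg hc0, abs_of_nonneg (by linarith)])
  have hle2 : Real.cosh (a - b) ≤ Real.cosh c :=
    Real.cosh_le_cosh.2 (by rw [abs_of_nonneg hc0]; exact abs_le.2 ⟨by linarith, by linarith⟩)
  rw [Real.cosh_add] at hle1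
  rw [Real.cosh_sub] at hle2
  have hsa : 0 ≤ Real.sinh a := Real.sinh_nonneg_iff.2 ha0
  obtain ⟨x, hx1, hx2⟩ : ∃ x : ℝ, x ^ 2 ≤ Real.sinh a ^ 2 ∧
      Real.cosh b * Real.cosh a - Real.sinh b * x = Real.cosh c := by
    rcases hb0.eq_or_lt with rfl | hb0
    · exact ⟨0, by simpa using sq_nonneg _, by rw [show a = c by linarith]; simp⟩
    · have hsb := Real.sinh_pos_iff.2 hb0
      refine ⟨(Real.cosh b * Real.cosh a - Real.cosh c) / Real.sinh b, ?_, by field_simp; ring⟩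
      rw [sq_le_sq, abs_of_nonneg hsa, abs_div, abs_of_pos hsb, div_le_iff₀ hsb, abs_le]
      constructor <;> linarith
  have hy : √(Real.sinh a ^ 2 - x ^ 2) ^ 2 = Real.sinh a ^ 2 - x ^ 2 :=
    Real.sq_sqrt (by linarith)
  have hqa := Real.cosh_sq a
  have hqb := Real.cosh_sq b
  obtain ⟨p, hp1, hp2, hp3⟩ := exists_hyp (Real.cosh_pos a) (X := x)
    (Y := √(Real.sinh a ^ 2 - x ^ 2)) (by rw [hy]; linarith)
  obtain ⟨u, hu1, hu2, hu3⟩ := exists_hyp one_pos (X := 0) (Y := 0) (by norm_num)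
  obtain ⟨w, hw1, hw2, hw3⟩ := exists_hyp (Real.cosh_pos b) (X := Real.sinh b) (Y := 0)
    (by linarith)
  refine ⟨p, u, w, dist_eq_of_cosh_eq ha0 ?_, dist_eq_of_cosh_eq hb0 ?_,
    dist_eq_of_cosh_eq hc0 ?_⟩
  · rw [hp1, hp2, hp3, hu1, hu2, hu3]
    ring
  · rw [hu1, hu2, hu3, hw1, hw2, hw3]
    ring
  · rw [hw1, hw2, hw3, hp1, hp2, hp3]
    linarith

/-- The hyperbolic plane of curvature `κ < 0` as a model plane. -/
def hyperbolicModel {κ : ℝ} (hκ : κ < 0) : ModelPlane κ ℍ² (hyperbolicDist κ) where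
  C t := Real.cosh (√(-κ) * t)
  S t := Real.sinh (√(-κ) * t)
  K _ _ := 0
  continuous_C := by fun_prop
  continuous_S := by fun_prop
  continuous_K := by fun_prop
  strictMonoOn_C := fun s hs t ht hst => by
    have hk : 0 < √(-κ) := Real.sqrt_pos.2 (neg_pos.2 hκ)
    exact Real.cosh_strictMonoOn (mul_nonneg hk.le hs.1) (mul_nonneg hk.le ht.1)
      (mul_lt_mul_of_pos_left hst hk)
  S_zero := by simp
  S_pos := fun t ht _ =>
    Real.sinh_pos_iff.2 (mul_pos (Real.sqrt_pos.2 (neg_pos.2 hκ)) ht)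
  collinear := fun l s => by
    have h : √(-κ) * l = √(-κ) * s + √(-κ) * (l - s) := by ring
    rw [h, Real.sinh_add, mul_zero, Real.cosh_zero]
    ring
  rho_dist_self := fun x => by rw [hyperbolicDist, dist_self, zero_div]
  rho_dist_comm := fun x y => by rw [hyperbolicDist, dist_comm, hyperbolicDist]
  rho_dist_triangle := fun x y z => by
    rw [hyperbolicDist, hyperbolicDist, hyperbolicDist, ← add_div]
    gcongr
    exact dist_triangle _ _ _
  rho_dist_nonneg := fun x y => div_nonneg dist_nonneg (Real.sqrt_nonneg _)
  rho_dist_le := fun x y h => (lt_asymm hκ h).elim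
  stewart := fun p u w z _ h => by
    have hk : 0 < √(-κ) := Real.sqrt_pos.2 (neg_pos.2 hκ)
    simp only [hyperbolicDist, mul_div_cancel₀ _ hk.ne'] at h ⊢
    rw [← add_div, div_left_inj' hk.ne'] at h
    rw [hyperbolic_stewart p u w z h, sub_zero]
  exists_between := fun u w s _ hs hsl => by
    have hk : 0 < √(-κ) := Real.sqrt_pos.2 (neg_pos.2 hκ)
    rw [hyperbolicDist] at hsl
    obtain ⟨z, h1, h2⟩ := hyperbolic_exists_between u w (s := s * √(-κ)) (by positivity)
      ((le_div_iff₀ hk).1 hsl)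
    refine ⟨z, ?_, ?_⟩
    · rw [hyperbolicDist, h1]
      field_simp
    · rw [hyperbolicDist, h2, hyperbolicDist]
      field_simp
  exists_triangle := fun a b c ha hb hc _ => by
    have hk : 0 < √(-κ) := Real.sqrt_pos.2 (neg_pos.2 hκ)
    obtain ⟨p, u, w, h1, h2, h3⟩ := hyperbolic_exists_triangle
      (a := a * √(-κ)) (b := b * √(-κ)) (c := c * √(-κ)) (by nlinarith) (by nlinarith)
      (by nlinarith)
    refine ⟨p, u, w, ?_, ?_, ?_⟩
    · rw [hyperbolicDist, h1]; field_simp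
    · rw [hyperbolicDist, h2]; field_simp
    · rw [hyperbolicDist, h3]; field_simp

end Hyperbolic

/-! ### The `CAT(κ)` condition in the limit -/

namespace QIApproximation

variable {X : ℕ → Type*} [∀ n, MetricSpace (X n)] {Y : Type*} [MetricSpace Y]
  (A : QIApproximation X Y)

include A in
lemma catInequality_and_isCAT {κ : ℝ} (hX : ∀ n, IsCAT (X n) κ) :
    CATInequality Y κ ∧ (CompleteSpace Y → IsCAT Y κ) := by
  have hgeo (n : ℕ) := (hX n).1
  rcases lt_trichotomy κ 0 with hκ | rfl | hκ
  · obtain ⟨h1, h2⟩ := A.triangleComparison_and_geodesic (hyperbolicModel hκ)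
      (fun n => (hX n).2.2.2 hκ) hgeo
    have h : CATInequality Y κ :=
      ⟨fun h => (hκ.ne h).elim, fun h => (lt_asymm hκ h).elim, fun _ => h1⟩
    exact ⟨h, fun hY => ⟨h2 hY, h⟩⟩
  · obtain ⟨h1, h2⟩ := A.triangleComparison_and_geodesic euclideanModel
      (fun n => (hX n).2.1 rfl) hgeo
    have h : CATInequality Y 0 :=
      ⟨fun _ => h1, fun h => (lt_irrefl _ h).elim, fun h => (lt_irrefl _ h).elim⟩
    exact ⟨h, fun hY => ⟨h2 hY, h⟩⟩
  · obtain ⟨h1, h2⟩ := A.triangleComparison_and_geodesic (sphereModel hκ)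
      (fun n => (hX n).2.2.1 hκ) hgeo
    have h : CATInequality Y κ :=
      ⟨fun h => (hκ.ne' h).elim, fun _ => h1, fun h => (lt_asymm hκ h).elim⟩
    exact ⟨h, fun hY => ⟨h2 hY, h⟩⟩

end QIApproximation

end QIConv

end

theorem mainTheorem1 {X : ℕ → Type*} [∀ k, MetricSpace (X k)] {Y : Type*} [MetricSpace Y]
    (hXY : Tendsto (fun k => QIConv.qiDist (X k) Y) atTop (𝓝 0)) :
    -- total boundedness
    ((∀ k, TotallyBounded (Set.univ : Set (X k))) → TotallyBounded (Set.univ : Set Y)) ∧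
    -- boundedness, and convergence of the diameters in `[0, ∞]`
    ((∀ k, Bornology.IsBounded (Set.univ : Set (X k))) →
      Bornology.IsBounded (Set.univ : Set Y)) ∧
    Tendsto (fun k => Metric.ediam (Set.univ : Set (X k))) atTop
      (𝓝 (Metric.ediam (Set.univ : Set Y))) ∧
    -- separability
    ((∀ k, TopologicalSpace.SeparableSpace (X k)) → TopologicalSpace.SeparableSpace Y) ∧
    -- properness
    (CompleteSpace Y → (∀ k, ProperSpace (X k)) → ProperSpace Y) ∧
    -- length spaces
    (CompleteSpace Y → (∀ k, QIConv.IsLengthSpace (X k)) → QIConv.IsLengthSpace Y) ∧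
    -- proper geodesic spaces
    (CompleteSpace Y → (∀ k, ProperSpace (X k) ∧ QIConv.IsGeodesicSpace (X k)) →
      ProperSpace Y ∧ QIConv.IsGeodesicSpace Y) ∧
    -- hyperbolicity, with the same constant
    (∀ δ : ℝ, (∀ k, QIConv.IsHyperbolic (X k) δ) → QIConv.IsHyperbolic Y δ) ∧
    -- the CAT condition
    (∀ κ : ℝ, (∀ k, QIConv.IsCAT (X k) κ) →
      QIConv.CATInequality Y κ ∧ (CompleteSpace Y → QIConv.IsCAT Y κ)) := by
  -- The selected spaces suffice for every inherited property; only the convergence of the diameters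
  -- needs the whole sequence.
  obtain ⟨φ, ⟨A⟩⟩ := QIConv.exists_qiApproximation hXY
  exact ⟨fun h => A.totallyBounded fun n => (h (φ n)).subset (Set.subset_univ _),
    fun h => A.isBounded_univ fun n => h (φ n),
    QIConv.tendsto_ediam hXY,
    fun h => A.separableSpace fun n => h (φ n),
    fun _ h => A.properSpace fun n => h (φ n),
    fun _ h => A.isLengthSpace fun n => h (φ n),
    fun _ h =>
      have hY : ProperSpace Y := A.properSpace fun n => (h (φ n)).1
      ⟨hY, A.isGeodesicSpace fun n => (h (φ n)).2⟩,
    fun _ h => A.isHyperbolic fun n => h (φ n),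
    fun _ h => A.catInequality_and_isCAT fun n => h (φ n)⟩
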